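/- Let $\mathcal G$ be one of the R. Thompson groups $F$, $T$, $V$. Here $V$ is the group of all maps of the Cantor set $\{0,1\}^{\mathbb N}$ given by tree diagrams $(T_+,\sigma,T_-)$: $T_+,T_-$ are finite full rooted plane binary trees with the same number of leaves, $\sigma$ is a bijection from the leaves of $T_+$ to the leaves of $T_-$ (both numbered from left to right), and for each leaf $o$ of $T_+$ the map sends $uw$ to $vw$ for every infinite binary word $w$, where $u$ and $v$ are the binary words labelling the paths from the root to $o$ in $T_+$ and to $\sigma(o)$ in $T_-$ (left edges are labelled $0$, right edges $1$). The subgroup $T$ consists of the maps given by diagrams in which $\sigma$ is a cyclic rotation, and $F$ of those given by diagrams in which $\sigma$ is the identity. Then $\mathcal G$ is finitely generated and has a linear divergence function. That is, for every finite generating set $S$ of $\mathcal G$ and every real $0<\delta\le\frac14$, let $f(n)\in\mathbb N\cup\{\infty\}$ be the smallest value such that every two vertices of the Cayley graph $\mathrm{Cay}(\mathcal G,S)$ at distance $n$ from the identity can be connected by a path in $\mathrm{Cay}(\mathcal G,S)$ of length at most $f(n)$ avoiding the closed ball of radius $\delta n$ centered at the identity (with $f(n)=\infty$ if some such pair cannot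 be connected in this way); then there is a constant $C$ such that $f(n)\le Cn$ and $n\le Cf(n)$ for all $n\ge 1$. Equivalently, no asymptotic cone of $\mathcal G$ has cut-points: for every finite generating set of $\mathcal G$, every non-principal ultrafilter $\omega$ on $\mathbb N$, every sequence of observation points $e_n\in\mathcal G$ and every sequence of scaling constants $d_n\geq 0$ with $\lim_\omega d_n=\infty$, the asymptotic cone $\mathrm{Con}^\omega(\mathcal G,(e_n),(d_n))$ (with respect to the word metric) remains connected after removal of any one of its points. -/

import Mathlib

open Filter Topology
open scoped NNReal

/-! ### Binary trees, tree diagrams, and the Thompson groups -/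

/-- Finite full rooted plane binary trees. -/
inductive BinTree where
  | leaf : BinTree
  | caret : BinTree → BinTree → BinTree

/-- The branches of a tree: the binary words labelling the paths from the root to the leaves
(`false` is the label `0` of a left edge, `true` is the label `1` of a right edge), listed from
left to right. -/
def BinTree.branches : BinTree → List (List Bool)
  | .leaf => [[]]
  | .caret l r => l.branches.map (fun u => false :: u) ++ r.branches.map (fun u => true :: u)

/-- A tree diagram `(T₊, σ, T₋)`: two trees and a bijection from the leaves of the first to the
leaves of the second, where leaves are numbered from left to right starting with `0`. -/
structure TreeDiagram where
  source : BinTree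
  target : BinTree
  perm : Fin source.branches.length ≃ Fin target.branches.length

/-- The permutation of the tree diagram is cyclic: it is a rotation `i ↦ i + k` modulo the number
of leaves. -/
def TreeDiagram.IsCyclic (d : TreeDiagram) : Prop :=
  ∃ k : ℕ, ∀ i, (d.perm i : ℕ) = ((i : ℕ) + k) % d.target.branches.length

/-- The permutation of the tree diagram is the identity. -/
def TreeDiagram.IsTrivial (d : TreeDiagram) : Prop :=
  ∀ i, (d.perm i : ℕ) = i

/-- The Cantor set, as the set of infinite binary words. -/
abbrev CantorSet : Type := Stream' Bool

/-- `g` takes the branch `u` onto `v`: it maps `uw` to `vw` for every infinite word `w`. -/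
def TakesBranch (g : Equiv.Perm CantorSet) (u v : List Bool) : Prop :=
  ∀ w : CantorSet, g (u ++ₛ w) = v ++ₛ w

/-- The map `g` of the Cantor set corresponds to the tree diagram `d`: for each leaf `i` of the
first tree, `g` takes the branch of `i` onto the branch of `σ(i)` in the second tree. -/
def TreeDiagram.Represents (d : TreeDiagram) (g : Equiv.Perm CantorSet) : Prop :=
  ∀ i, TakesBranch g (d.source.branches.get i) (d.target.branches.get (d.perm i))

/-! Auxiliary facts: the sets of maps given by the three kinds of tree diagrams are groups. -/

namespace ThompsonAux

theorem append_unique : ∀ v v' : List Bool,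
    (∀ w : CantorSet, v ++ₛ w = v' ++ₛ w) → v = v'
  | [], [], _ => rfl
  | [], b :: v', h => by
    exfalso
    have h1 := congrArg Stream'.head (h (Stream'.const (!b)))
    simp [Stream'.cons_append_stream, Stream'.head] at h1
  | b :: v, [], h => by
    exfalso
    have h1 := congrArg Stream'.head (h (Stream'.const (!b)))
    simp [Stream'.cons_append_stream, Stream'.head] at h1
  | b :: v, b' :: v', h => by
    have hb : b = b' := by
      have h1 := congrArg Stream'.head (h (Stream'.const true))
      simpa [Stream'.cons_append_stream] using h1
    have hv : v = v' := by
      apply append_unique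
      intro w
      have h1 := congrArg Stream'.tail (h w)
      simpa [Stream'.cons_append_stream] using h1
    rw [hb, hv]

open Classical in
noncomputable def img (g : Equiv.Perm CantorSet) (u : List Bool) : List Bool :=
  if h : ∃ v, TakesBranch g u v then h.choose else []

theorem img_eq {g : Equiv.Perm CantorSet} {u v : List Bool} (h : TakesBranch g u v) :
    img g u = v := by
  have he : ∃ v, TakesBranch g u v := ⟨v, h⟩
  rw [img, dif_pos he]
  exact append_unique _ _ fun w => (he.choose_spec w).symm.trans (h w)

theorem takes_append {g : Equiv.Perm CantorSet} {u v : List Bool} (h : TakesBranch g u v)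
    (x : List Bool) : TakesBranch g (u ++ x) (v ++ x) := fun w => by
  rw [Stream'.append_append_stream, Stream'.append_append_stream, h]

theorem takes_inv {g : Equiv.Perm CantorSet} {u v : List Bool} (h : TakesBranch g u v) :
    TakesBranch g⁻¹ v u := fun w => by
  rw [← h w]; simp

theorem takes_mul {g h : Equiv.Perm CantorSet} {u v x : List Bool} (hg : TakesBranch g u v)
    (hh : TakesBranch h v x) : TakesBranch (h * g) u x := fun w => by
  rw [Equiv.Perm.mul_apply, hg, hh]

/-- Attach the tree `S u` at each branch `u`. -/
def graft : BinTree → (List Bool → BinTree) → BinTree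
  | .leaf, S => S []
  | .caret l r, S => .caret (graft l fun u => S (false :: u)) (graft r fun u => S (true :: u))

theorem branches_graft : ∀ (T : BinTree) (S : List Bool → BinTree),
    (graft T S).branches = T.branches.flatMap fun u => (S u).branches.map fun x => u ++ x
  | .leaf, S => by simp [graft, BinTree.branches]
  | .caret l r, S => by
    simp [graft, BinTree.branches, branches_graft l, branches_graft r, List.map_flatMap,
      List.flatMap_map, List.flatMap_append, Function.comp_def]

theorem common_graft : ∀ A B : BinTree, ∃ S S', graft A S = graft B S'
  | .leaf, B => ⟨fun _ => B, fun _ => .leaf, by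
      induction B with
      | leaf => rfl
      | caret l r hl hr => simp only [graft] at hl hr ⊢; rw [← hl, ← hr]⟩
  | .caret l r, .leaf => ⟨fun _ => .leaf, fun _ => .caret l r, by
      have key : ∀ B : BinTree, graft B (fun _ => .leaf) = B := by
        intro B
        induction B with
        | leaf => rfl
        | caret l r hl hr => simp only [graft] at hl hr ⊢; rw [hl, hr]
      rw [key]; rfl⟩
  | .caret l r, .caret l' r' => by
    obtain ⟨S1, S1', h1⟩ := common_graft l l'
    obtain ⟨S2, S2', h2⟩ := common_graft r r'
    refine ⟨fun u => match u with | [] => .leaf | false :: u => S1 u | true :: u => S2 u,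
      fun u => match u with | [] => .leaf | false :: u => S1' u | true :: u => S2' u, ?_⟩
    simp only [graft]
    rw [h1, h2]

structure Good (R : List (List Bool) → List (List Bool) → Prop) : Prop where
  refl : ∀ L, R L L
  symm : ∀ {L M}, R L M → R M L
  trans : ∀ {L M N}, R L M → R M N → R L N
  map : ∀ {L M} (f : List Bool → List Bool), R L M → R (L.map f) (M.map f)
  flatMap : ∀ {L M} (f : List Bool → List (List Bool)), R L M → R (L.flatMap f) (M.flatMap f)

theorem good_eq : Good (fun L M => L = M) where
  refl _ := rfl
  symm h := h.symm
  trans h h' := h.trans h'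
  map f h := by rw [h]
  flatMap f h := by rw [h]

theorem good_perm : Good List.Perm where
  refl := List.Perm.refl
  symm h := h.symm
  trans h h' := h.trans h'
  map f h := h.map f
  flatMap f h := h.flatMap_right f

theorem good_rot : Good List.IsRotated where
  refl := List.IsRotated.refl
  symm h := h.symm
  trans h h' := h.trans h'
  map f h := h.map f
  flatMap {L M} f h := by
    obtain ⟨n, hn, rfl⟩ := List.isRotated_iff_mod.1 h
    rw [List.rotate_eq_drop_append_take hn, List.flatMap_append]
    conv_lhs => rw [← List.take_append_drop n L, List.flatMap_append]
    exact List.isRotated_append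

def InClass (R : List (List Bool) → List (List Bool) → Prop) (g : Equiv.Perm CantorSet) : Prop :=
  ∃ A B : BinTree, (∀ u ∈ A.branches, TakesBranch g u (img g u)) ∧
    R (A.branches.map (img g)) B.branches

variable {R : List (List Bool) → List (List Bool) → Prop}

theorem inClass_one (hR : Good R) : InClass R 1 := by
  have h : ∀ u, TakesBranch 1 u u := fun u w => rfl
  refine ⟨.leaf, .leaf, fun u _ => by rw [img_eq (h u)]; exact h u, ?_⟩
  have : (BinTree.leaf.branches.map (img 1)) = BinTree.leaf.branches := by
    simp [BinTree.branches, img_eq (h [])]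
  rw [this]; exact hR.refl _

theorem map_img_inv {g : Equiv.Perm CantorSet} (L : List (List Bool))
    (h : ∀ u ∈ L, TakesBranch g u (img g u)) : (L.map (img g)).map (img g⁻¹) = L := by
  rw [List.map_map]
  conv_rhs => rw [← List.map_id L]
  exact List.map_congr_left fun u hu => img_eq (takes_inv (h u hu))

theorem inClass_inv (hR : Good R) (hP : ∀ {L M}, R L M → L.Perm M) {g : Equiv.Perm CantorSet}
    (hg : InClass R g) : InClass R g⁻¹ := by
  obtain ⟨A, B, h1, h2⟩ := hg
  refine ⟨B, A, fun v hv => ?_, ?_⟩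
  · obtain ⟨u, hu, rfl⟩ := List.mem_map.1 ((hP h2).mem_iff.2 hv)
    have := takes_inv (h1 u hu)
    rwa [img_eq this]
  · have := hR.map (img g⁻¹) h2
    rw [map_img_inv _ h1] at this
    exact hR.symm this

/-- A refinement of the target tree can be followed by a refinement of the source tree. -/
theorem inClass_refine (hR : Good R) {g : Equiv.Perm CantorSet} {A B : BinTree}
    (h1 : ∀ u ∈ A.branches, TakesBranch g u (img g u)) (h2 : R (A.branches.map (img g)) B.branches)
    (S : List Bool → BinTree) :
    (∀ u ∈ (graft A fun u => S (img g u)).branches, TakesBranch g u (img g u)) ∧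
      R ((graft A fun u => S (img g u)).branches.map (img g)) (graft B S).branches := by
  constructor
  · intro u hu
    rw [branches_graft] at hu
    obtain ⟨u', hu', hx⟩ := List.mem_flatMap.1 hu
    obtain ⟨x, hx, rfl⟩ := List.mem_map.1 hx
    have := takes_append (h1 u' hu') x
    rwa [img_eq this]
  · have h3 := hR.flatMap (fun v => (S v).branches.map fun x => v ++ x) h2
    rw [branches_graft, branches_graft]
    convert h3 using 1
    rw [List.map_flatMap, List.flatMap_map]
    refine List.flatMap_congr fun u hu => ?_
    rw [List.map_map]
    exact List.map_congr_left fun x _ => img_eq (takes_append (h1 u hu) x)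

theorem inClass_mul (hR : Good R) (hP : ∀ {L M}, R L M → L.Perm M) {g h : Equiv.Perm CantorSet}
    (hh : InClass R h) (hg : InClass R g) : InClass R (h * g) := by
  obtain ⟨A, B, h1, h2⟩ := hg
  obtain ⟨B', C, h3, h4⟩ := inClass_inv hR hP hh
  obtain ⟨S, S', hS⟩ := common_graft B C
  obtain ⟨a1, a2⟩ := inClass_refine hR h1 h2 S
  obtain ⟨b1, b2⟩ := inClass_refine hR h3 h4 S'
  rw [← hS] at b2
  set A' := graft A fun u => S (img g u)
  set D := graft B' fun u => S' (img h⁻¹ u)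
  have key : ∀ u ∈ A'.branches, TakesBranch (h * g) u (img h (img g u)) := by
    intro u hu
    have hm := (hP (hR.trans a2 (hR.symm b2))).mem_iff.1 (List.mem_map_of_mem (f := img g) hu)
    obtain ⟨v, hv, hvu⟩ := List.mem_map.1 hm
    have t := takes_inv (b1 v hv)
    rw [inv_inv, hvu] at t
    have := takes_mul (a1 u hu) t
    rwa [img_eq t]
  refine ⟨A', D, fun u hu => ?_, ?_⟩
  · rw [img_eq (key u hu)]; exact key u hu
  · have := hR.map (img h) (hR.trans a2 (hR.symm b2))
    have e := map_img_inv _ b1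
    rw [inv_inv] at e
    rw [e, List.map_map] at this
    convert this using 1
    exact List.map_congr_left fun u hu => img_eq (key u hu)

theorem map_img_of_represents {d : TreeDiagram} {g : Equiv.Perm CantorSet}
    (h : d.Represents g) :
    d.source.branches.map (img g) = List.ofFn fun i => d.target.branches.get (d.perm i) := by
  apply List.ext_get
  · simp
  · intro n h1 h2
    simp only [List.length_map] at h1
    simpa using img_eq (h ⟨n, h1⟩)

theorem takes_of_represents {d : TreeDiagram} {g : Equiv.Perm CantorSet} (h : d.Represents g) :
    ∀ u ∈ d.source.branches, TakesBranch g u (img g u) := by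
  intro u hu
  obtain ⟨i, rfl⟩ := List.get_of_mem hu
  rw [img_eq (h i)]; exact h i

theorem inClass_perm (g : Equiv.Perm CantorSet) :
    InClass List.Perm g ↔ ∃ d : TreeDiagram, d.Represents g := by
  constructor
  · rintro ⟨A, B, h1, h2⟩
    refine ⟨⟨A, B, (finCongr (by simp)).trans
      (Equiv.ofBijective h2.idxBij ?_)⟩, fun i => ?_⟩
    · exact ⟨h2.idxBij_injective, h2.idxBij_surjective⟩
    · have : B.branches.get (h2.idxBij (finCongr (by simp) i)) = img g (A.branches.get i) := by
        simp
      change TakesBranch g _ (B.branches.get (h2.idxBij (finCongr (by simp) i)))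
      rw [this]
      exact h1 _ (List.get_mem _ _)
  · rintro ⟨d, hd⟩
    refine ⟨d.source, d.target, takes_of_represents hd, ?_⟩
    rw [map_img_of_represents hd]
    have hn : d.source.branches.length = d.target.branches.length := by
      simpa using Fintype.card_congr d.perm
    have := Equiv.Perm.ofFn_comp_perm ((finCongr hn).symm.trans d.perm) d.target.branches.get
    rw [List.ofFn_get] at this
    convert this using 1
    apply List.ext_get
    · simp [hn]
    · intro n _ _
      simp [finCongr]

theorem inClass_rot (g : Equiv.Perm CantorSet) :
    InClass List.IsRotated g ↔ ∃ d : TreeDiagram, d.IsCyclic ∧ d.Represents g := by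
  constructor
  · rintro ⟨A, B, h1, h2⟩
    obtain ⟨k, hk⟩ := h2.symm
    have hn : A.branches.length = B.branches.length := by
      simpa using h2.perm.length_eq
    have hpos : ∀ i : Fin A.branches.length, 0 < B.branches.length := fun i => by
      have := i.2; omega
    let f : Fin A.branches.length → Fin B.branches.length := fun i =>
      ⟨((i : ℕ) + k) % B.branches.length, Nat.mod_lt _ (hpos i)⟩
    have hf : Function.Injective f := by
      intro i j hij
      have h3 : (i : ℕ) + k ≡ j + k [MOD B.branches.length] := congrArg Fin.val hij
      have h4 := Nat.ModEq.add_right_cancel' k h3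
      exact Fin.ext (Nat.ModEq.eq_of_lt_of_lt h4 (hn ▸ i.2) (hn ▸ j.2))
    have hb : Function.Bijective f :=
      (Fintype.bijective_iff_injective_and_card f).2 ⟨hf, by simpa using hn⟩
    refine ⟨⟨A, B, Equiv.ofBijective f hb⟩, ⟨k, fun i => rfl⟩, fun i => ?_⟩
    have : B.branches.get (f i) = img g (A.branches.get i) := by
      have h5 : (B.branches.rotate k)[(i : ℕ)]'(by simp [← hn]) = img g (A.branches.get i) := by
        simp [hk]
      rw [← h5, List.getElem_rotate]
      rfl
    change TakesBranch g _ (B.branches.get (f i))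
    rw [this]
    exact h1 _ (List.get_mem _ _)
  · rintro ⟨d, ⟨k, hk⟩, hd⟩
    refine ⟨d.source, d.target, takes_of_represents hd, List.IsRotated.symm ⟨k, ?_⟩⟩
    rw [map_img_of_represents hd]
    have hn : d.source.branches.length = d.target.branches.length := by
      simpa using Fintype.card_congr d.perm
    apply List.ext_get
    · simp [hn]
    · intro n _ _
      simp [List.getElem_rotate, hk]

theorem inClass_eq (g : Equiv.Perm CantorSet) :
    InClass (fun L M => L = M) g ↔ ∃ d : TreeDiagram, d.IsTrivial ∧ d.Represents g := by
  constructor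
  · rintro ⟨A, B, h1, h2⟩
    have hn : A.branches.length = B.branches.length := by
      rw [← h2]; simp
    refine ⟨⟨A, B, finCongr hn⟩, fun i => rfl, fun i => ?_⟩
    have : B.branches.get (finCongr hn i) = img g (A.branches.get i) := by
      simp [← h2]
    change TakesBranch g _ (B.branches.get (finCongr hn i))
    rw [this]
    exact h1 _ (List.get_mem _ _)
  · rintro ⟨d, hk, hd⟩
    refine ⟨d.source, d.target, takes_of_represents hd, ?_⟩
    rw [map_img_of_represents hd]
    have hn : d.source.branches.length = d.target.branches.length := by
      simpa using Fintype.card_congr d.perm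
    apply List.ext_get
    · simp [hn]
    · intro n _ _
      simp [hk _]

end ThompsonAux

/-- Thompson's group `V`: all maps of the Cantor set represented by tree diagrams. -/
def thompsonV : Subgroup (Equiv.Perm CantorSet) where
  carrier := {g | ∃ d : TreeDiagram, d.Represents g}
  one_mem' := (ThompsonAux.inClass_perm _).1 (ThompsonAux.inClass_one ThompsonAux.good_perm)
  mul_mem' {a b} ha hb := (ThompsonAux.inClass_perm _).1
    (ThompsonAux.inClass_mul ThompsonAux.good_perm id ((ThompsonAux.inClass_perm a).2 ha)
      ((ThompsonAux.inClass_perm b).2 hb))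
  inv_mem' {a} ha := (ThompsonAux.inClass_perm _).1
    (ThompsonAux.inClass_inv ThompsonAux.good_perm id ((ThompsonAux.inClass_perm a).2 ha))

/-- Thompson's group `T`: all maps represented by tree diagrams with a cyclic permutation. -/
def thompsonT : Subgroup (Equiv.Perm CantorSet) where
  carrier := {g | ∃ d : TreeDiagram, d.IsCyclic ∧ d.Represents g}
  one_mem' := (ThompsonAux.inClass_rot _).1 (ThompsonAux.inClass_one ThompsonAux.good_rot)
  mul_mem' {a b} ha hb := (ThompsonAux.inClass_rot _).1
    (ThompsonAux.inClass_mul ThompsonAux.good_rot List.IsRotated.perm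
      ((ThompsonAux.inClass_rot a).2 ha) ((ThompsonAux.inClass_rot b).2 hb))
  inv_mem' {a} ha := (ThompsonAux.inClass_rot _).1
    (ThompsonAux.inClass_inv ThompsonAux.good_rot List.IsRotated.perm
      ((ThompsonAux.inClass_rot a).2 ha))

/-- Thompson's group `F`: all maps represented by tree diagrams with the identity permutation. -/
def thompsonF : Subgroup (Equiv.Perm CantorSet) where
  carrier := {g | ∃ d : TreeDiagram, d.IsTrivial ∧ d.Represents g}
  one_mem' := (ThompsonAux.inClass_eq _).1 (ThompsonAux.inClass_one ThompsonAux.good_eq)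
  mul_mem' {a b} ha hb := (ThompsonAux.inClass_eq _).1
    (ThompsonAux.inClass_mul ThompsonAux.good_eq (fun h => h ▸ List.Perm.refl _)
      ((ThompsonAux.inClass_eq a).2 ha) ((ThompsonAux.inClass_eq b).2 hb))
  inv_mem' {a} ha := (ThompsonAux.inClass_eq _).1
    (ThompsonAux.inClass_inv ThompsonAux.good_eq (fun h => h ▸ List.Perm.refl _)
      ((ThompsonAux.inClass_eq a).2 ha))

/-! ### Divergence -/

/-- The divergence function, with parameter `δ`, of the Cayley graph of `G` with respect to `S`:
the smallest function such that any two vertices at distance `n` from the identity can be joined by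
a path of length at most its value at `n` that avoids the (closed) ball of radius `δ n` about the
identity. The value is `⊤` if some such pair of vertices cannot be joined. -/
noncomputable def divergence {G : Type*} [Group G] (S : Set G) (δ : ℝ) (n : ℕ) : ℕ∞ :=
  ⨆ (g : G) (h : G) (_ : (SimpleGraph.mulCayley S).dist 1 g = n)
    (_ : (SimpleGraph.mulCayley S).dist 1 h = n),
    ⨅ (p : (SimpleGraph.mulCayley S).Walk g h)
      (_ : ∀ v ∈ p.support, δ * (n : ℝ) < ((SimpleGraph.mulCayley S).dist 1 v : ℝ)),
      (p.length : ℕ∞)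

/-- `f` is linear up to multiplicative constants, above and below. The value at `0` is ignored:
for a divergence function, the only vertex at distance `0` lies in the ball to be avoided. -/
def IsLinearFunction (f : ℕ → ℕ∞) : Prop :=
  ∃ C : ℕ, ∀ n : ℕ, 1 ≤ n → f n ≤ (C : ℕ∞) * n ∧ (n : ℕ∞) ≤ (C : ℕ∞) * f n

/-- `G` is finitely generated and, for each finite generating set and each `0 < δ ≤ 1/4`, the
divergence function of its Cayley graph is linear. -/
def HasLinearDivergence (G : Type*) [Group G] : Prop :=
  Group.FG G ∧ ∀ S : Set G, S.Finite → Subgroup.closure S = ⊤ →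
    ∀ δ : ℝ, 0 < δ → δ ≤ 1 / 4 → IsLinearFunction (divergence S δ)

/-! ### Asymptotic cones -/

/-- Sequences of points of `X` at distance `O(d n)` from the sequence `e` of observation points,
along the ultrafilter `ω`. -/
def ConeSeq (X : Type*) [PseudoMetricSpace X] (ω : Ultrafilter ℕ) (e : ℕ → X) (d : ℕ → ℝ≥0) :
    Type _ :=
  {x : ℕ → X // ∃ C : ℝ, ∀ᶠ n in (ω : Filter ℕ), dist (x n) (e n) / (d n : ℝ) ≤ C}

/-- The limit along `ω` of the rescaled distances `dist (x n) (y n) / d n`. -/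
noncomputable def coneDist {X : Type*} [PseudoMetricSpace X] {ω : Ultrafilter ℕ} {e : ℕ → X}
    {d : ℕ → ℝ≥0} (x y : ConeSeq X ω e d) : ℝ :=
  limUnder (ω : Filter ℕ) fun n => dist (x.1 n) (y.1 n) / (d n : ℝ)

theorem tendsto_coneDist {X : Type*} [PseudoMetricSpace X] {ω : Ultrafilter ℕ} {e : ℕ → X}
    {d : ℕ → ℝ≥0} (x y : ConeSeq X ω e d) :
    Tendsto (fun n => dist (x.1 n) (y.1 n) / (d n : ℝ)) ω (𝓝 (coneDist x y)) := by
  apply tendsto_nhds_limUnder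
  obtain ⟨C, hC⟩ := x.2
  obtain ⟨C', hC'⟩ := y.2
  have hmem : ∀ᶠ n in (ω : Filter ℕ),
      dist (x.1 n) (y.1 n) / (d n : ℝ) ∈ Set.Icc (0 : ℝ) (C + C') := by
    filter_upwards [hC, hC'] with n h h'
    refine ⟨by positivity, ?_⟩
    calc dist (x.1 n) (y.1 n) / (d n : ℝ)
        ≤ (dist (x.1 n) (e n) + dist (y.1 n) (e n)) / (d n : ℝ) := by
          gcongr; exact dist_triangle_right _ _ _
      _ ≤ C + C' := by rw [add_div]; exact add_le_add h h'
  obtain ⟨a, -, ha⟩ := (isCompact_Icc (a := (0 : ℝ)) (b := C + C')).ultrafilter_le_nhds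
    (ω.map fun n => dist (x.1 n) (y.1 n) / (d n : ℝ)) (le_principal_iff.2 hmem)
  exact ⟨a, ha⟩

noncomputable instance {X : Type*} [PseudoMetricSpace X] {ω : Ultrafilter ℕ} {e : ℕ → X}
    {d : ℕ → ℝ≥0} : PseudoMetricSpace (ConeSeq X ω e d) where
  dist := coneDist
  dist_self x := tendsto_nhds_unique (tendsto_coneDist x x) (by simp)
  dist_comm x y := by simp only [coneDist, dist_comm]
  dist_triangle x y z := by
    refine le_of_tendsto_of_tendsto' (tendsto_coneDist x z)
      ((tendsto_coneDist x y).add (tendsto_coneDist y z)) fun n => ?_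
    rw [← add_div]
    gcongr
    exact dist_triangle _ _ _

/-- The asymptotic cone of `X` with respect to the ultrafilter `ω`, the observation points `e` and
the scaling sequence `d`: sequences at finite limit distance from `e`, where sequences at limit
distance `0` from each other are identified, with the limit metric. -/
abbrev AsymptoticCone (X : Type*) [PseudoMetricSpace X] (ω : Ultrafilter ℕ) (e : ℕ → X)
    (d : ℕ → ℝ≥0) : Type _ :=
  SeparationQuotient (ConeSeq X ω e d)

theorem mulCayley_connected {G : Type*} [Group G] {S : Set G} (hS : Subgroup.closure S = ⊤) :
    (SimpleGraph.mulCayley S).Connected := by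
  have key : ∀ g h : G, (SimpleGraph.mulCayley S).Reachable h (h * g) := by
    intro g
    have hg : g ∈ Subgroup.closure S := by rw [hS]; trivial
    have step : ∀ h x : G, x ∈ S ∨ x⁻¹ ∈ S → (SimpleGraph.mulCayley S).Reachable h (h * x) := by
      intro h x hx
      by_cases hne : h = h * x
      · rw [← hne]
      · refine SimpleGraph.Adj.reachable ((SimpleGraph.mulCayley_adj _ _ _).2 ⟨hne, ?_⟩)
        simpa using hx
    induction hg using Subgroup.closure_induction with
    | mem x hx => exact fun h => step h x (Or.inl hx)
    | one => intro h; rw [mul_one]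
    | mul x y _ _ hx hy => intro h; rw [← mul_assoc]; exact (hx h).trans (hy _)
    | inv x _ hx => intro h; simpa using (hx (h * x⁻¹)).symm
  refine (SimpleGraph.connected_iff _).2 ⟨fun a b => ?_, ⟨1⟩⟩
  simpa using key (a⁻¹ * b) a

/-- The vertices of the Cayley graph of `G` with respect to a generating set `S`, as a metric space
with the graph distance. -/
structure CayleyVertices {G : Type*} [Group G] (S : Set G) (hS : Subgroup.closure S = ⊤) where
  elt : G

noncomputable instance {G : Type*} [Group G] (S : Set G) (hS : Subgroup.closure S = ⊤) :
    MetricSpace (CayleyVertices S hS) where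
  dist g h := ((SimpleGraph.mulCayley S).dist g.elt h.elt : ℝ)
  dist_self g := by simp
  dist_comm g h := by rw [SimpleGraph.dist_comm]
  dist_triangle g h k := by
    exact_mod_cast (mulCayley_connected hS).dist_triangle
  eq_of_dist_eq_zero {g h} h0 := by
    have := (mulCayley_connected hS).dist_eq_zero_iff.1 (Nat.cast_eq_zero.1 h0)
    cases g; cases h; simp_all

/-- The space `X` has a cut-point: a point whose removal disconnects `X`. -/
def HasCutPoint (X : Type*) [TopologicalSpace X] : Prop :=
  ∃ p : X, ¬ IsPreconnected ({p}ᶜ : Set X)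

/-- No asymptotic cone of a Cayley graph of `G` with respect to a finite generating set has
cut-points. (A Cayley graph and its set of vertices have the same asymptotic cones.) -/
def NoConeHasCutPoint (G : Type*) [Group G] : Prop :=
  ∀ (S : Set G), S.Finite → ∀ hS : Subgroup.closure S = ⊤,
    ∀ (ω : Ultrafilter ℕ), (ω : Filter ℕ) ≤ cofinite →
    ∀ (e : ℕ → CayleyVertices S hS) (d : ℕ → ℝ≥0), Tendsto d ω atTop →
      ¬ HasCutPoint (AsymptoticCone (CayleyVertices S hS) ω e d)

/-! The argument works for every group G with F ≤ G ≤ V. The only lower bound on word length comes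
from distortion of branches: a generator changes the length of a deep branch by a bounded amount, so
an element taking `a` to `b` has word length at least | |a| − |b| | / κ (`le_mul_wordLength`). Edges
of the Cayley graph multiply on the right, and the right factor of a product acts first.

Given g far from the identity, precompose with powers of `rotateRight` or its inverse, whichever
makes the distortion of g z^i grow with i (`exists_expanding`). Such a path cannot come close to the
identity: g z^i has length at least i/κ and also at least |g| − iμ. After linearly many steps the
new element g' takes a half [s] of the Cantor set to a proper cone j b. Now let u be a copy of
`rotateRight` supported on [s], and v a copy supported on the half opposite to j. The conjugate q =
g' u g'⁻¹ is supported on the cone j b, so it commutes with v. For m large compared with |g'|, the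
path g' u^m = q^m g' → q^m → q^m v^m = v^m q^m → v^m q^m g' = v^m g' u^m → v^m g' → v^m stays far
away, since at each moment q^m or v^m contributes a large distortion (`farJoined_pow_of_takes`).
Thus every far element is joined to one of two powers U j ^ m, and the same commutation joins these
two to each other. This is `linearlyJoined_of_between`.

`LinearlyJoined` gives the upper bound on the divergence once both vertices have been moved outwards
along geodesics, and in the limit it gives paths in asymptotic cones that avoid a given point.
Finite generation is proved by rotating all trees to right spines, which leaves only a rotation or a
permutation of the leaves of a spine to realize. -/

/-! ### Word length and paths in Cayley graphs -/

section CayleyGraph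

variable {Γ : Type*} [Group Γ] {S : Set Γ}

/-- Left multiplication, as an endomorphism of the Cayley graph. -/
def cayleyMulLeft (S : Set Γ) (k : Γ) : SimpleGraph.mulCayley S →g SimpleGraph.mulCayley S where
  toFun x := k * x
  map_rel' h := (SimpleGraph.mulCayley_adj_mul_iff_right).2 h

/-- The word length of an element with respect to `S`. -/
noncomputable def wordLength (S : Set Γ) (g : Γ) : ℕ := (SimpleGraph.mulCayley S).dist 1 g

theorem cayley_dist_mul_left (hS : Subgroup.closure S = ⊤) (k a b : Γ) :
    (SimpleGraph.mulCayley S).dist (k * a) (k * b) = (SimpleGraph.mulCayley S).dist a b := by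
  have key : ∀ k a b : Γ, (SimpleGraph.mulCayley S).dist (k * a) (k * b) ≤
      (SimpleGraph.mulCayley S).dist a b := by
    intro k a b
    obtain ⟨p, hp⟩ := (mulCayley_connected hS).exists_walk_length_eq_dist a b
    rw [← hp, ← SimpleGraph.Walk.length_map (cayleyMulLeft S k) p]
    exact SimpleGraph.dist_le _
  refine le_antisymm (key k a b) ?_
  simpa using key k⁻¹ (k * a) (k * b)

theorem cayley_dist_eq (hS : Subgroup.closure S = ⊤) (a b : Γ) :
    (SimpleGraph.mulCayley S).dist a b = wordLength S (a⁻¹ * b) := by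
  simpa [wordLength] using cayley_dist_mul_left hS a 1 (a⁻¹ * b)

theorem wordLength_one : wordLength S (1 : Γ) = 0 := SimpleGraph.dist_self

theorem wordLength_inv (hS : Subgroup.closure S = ⊤) (g : Γ) :
    wordLength S g⁻¹ = wordLength S g := by
  rw [wordLength, SimpleGraph.dist_comm, cayley_dist_eq hS]; simp

theorem wordLength_mul_le (hS : Subgroup.closure S = ⊤) (g h : Γ) :
    wordLength S (g * h) ≤ wordLength S g + wordLength S h := by
  have h1 := (mulCayley_connected hS).dist_triangle (u := 1) (v := g) (w := g * h)
  rwa [cayley_dist_eq hS g, inv_mul_cancel_left] at h1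

theorem wordLength_le_mul_add (hS : Subgroup.closure S = ⊤) (g h : Γ) :
    wordLength S g ≤ wordLength S (g * h) + wordLength S h := by
  have h1 := wordLength_mul_le hS (g * h) h⁻¹
  rwa [mul_inv_cancel_right, wordLength_inv hS] at h1

theorem wordLength_pow_le (hS : Subgroup.closure S = ⊤) (g : Γ) (i : ℕ) :
    wordLength S (g ^ i) ≤ i * wordLength S g := by
  induction i with
  | zero => simp [wordLength_one]
  | succ i ih =>
    rw [pow_succ]
    refine (wordLength_mul_le hS _ _).trans ?_
    rw [Nat.succ_mul]; omega

/-- A subadditive bound that holds for generators and their inverses propagates linearly. -/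
theorem wordLength_induction (hS : Subgroup.closure S = ⊤) {P : Γ → ℕ → Prop} {N : ℕ}
    (one : P 1 0) (mul : ∀ {g h n m}, P g n → P h m → P (g * h) (n + m))
    (gen : ∀ s ∈ S, P s N ∧ P s⁻¹ N) (g : Γ) : P g (N * wordLength S g) := by
  have key : ∀ (a b : Γ) (p : (SimpleGraph.mulCayley S).Walk a b),
      P (a⁻¹ * b) (N * p.length) := by
    intro a b p
    induction p with
    | nil => simpa using one
    | @cons u v w h p ih =>
      have hs : P (u⁻¹ * v) N := by
        rcases ((SimpleGraph.mulCayley_adj _ _ _).1 h).2 with h | h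
        · exact (gen _ h).1
        · simpa using (gen _ h).2
      have h1 := mul hs ih
      rw [SimpleGraph.Walk.length_cons, mul_add, mul_one, add_comm]
      convert h1 using 1
      group
  obtain ⟨p, hp⟩ := (mulCayley_connected hS).exists_walk_length_eq_dist 1 g
  have h1 := key _ _ p
  rw [hp] at h1
  simpa [wordLength] using h1

/-- `g` and `h` can be joined by a path of length at most `L` whose vertices all have word length
at least `R`. -/
def FarJoined (S : Set Γ) (R L : ℕ) (g h : Γ) : Prop :=
  ∃ p : (SimpleGraph.mulCayley S).Walk g h, p.length ≤ L ∧ ∀ v ∈ p.support, R ≤ wordLength S v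

theorem FarJoined.symm {R L : ℕ} {g h : Γ} (H : FarJoined S R L g h) : FarJoined S R L h g := by
  obtain ⟨p, hp, hR⟩ := H
  exact ⟨p.reverse, by simpa using hp, fun v hv => hR v (by simpa using hv)⟩

theorem FarJoined.trans {R L L' : ℕ} {g h k : Γ} (H : FarJoined S R L g h)
    (H' : FarJoined S R L' h k) : FarJoined S R (L + L') g k := by
  obtain ⟨p, hp, hR⟩ := H
  obtain ⟨q, hq, hR'⟩ := H'
  refine ⟨p.append q, by rw [SimpleGraph.Walk.length_append]; omega, fun v hv => ?_⟩
  rcases (SimpleGraph.Walk.mem_support_append_iff _ _).1 hv with h | h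
  exacts [hR v h, hR' v h]

theorem FarJoined.mono {R R' L L' : ℕ} {g h : Γ} (H : FarJoined S R L g h) (hR : R' ≤ R)
    (hL : L ≤ L') : FarJoined S R' L' g h := by
  obtain ⟨p, hp, hv⟩ := H
  exact ⟨p, hp.trans hL, fun v h => hR.trans (hv v h)⟩

theorem FarJoined.refl {R : ℕ} {g : Γ} (h : R ≤ wordLength S g) : FarJoined S R 0 g g :=
  ⟨.nil, le_rfl, fun v hv => by
    rw [SimpleGraph.Walk.support_nil, List.mem_singleton] at hv; rwa [hv]⟩

/-- A geodesic from `g` to `g * k` stays within `wordLength S k` of `g`. -/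
theorem farJoined_mul (hS : Subgroup.closure S = ⊤) {R : ℕ} {g k : Γ}
    (h : R + wordLength S k ≤ wordLength S g) : FarJoined S R (wordLength S k) g (g * k) := by
  obtain ⟨p, hp⟩ := (mulCayley_connected hS).exists_walk_length_eq_dist g (g * k)
  rw [cayley_dist_eq hS, inv_mul_cancel_left] at hp
  refine ⟨p, hp.le, fun v hv => ?_⟩
  classical
  have h1 := SimpleGraph.dist_le (p.takeUntil v hv)
  have h2 := p.length_takeUntil_le_length hv
  rw [cayley_dist_eq hS] at h1
  have h3 := wordLength_le_mul_add hS g (g⁻¹ * v)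
  rw [mul_inv_cancel_left] at h3
  omega

theorem farJoined_pow (hS : Subgroup.closure S = ⊤) {R : ℕ} {g u : Γ} {m : ℕ}
    (h : ∀ i ≤ m, R + wordLength S u ≤ wordLength S (g * u ^ i)) :
    FarJoined S R (m * wordLength S u) g (g * u ^ m) := by
  induction m with
  | zero =>
    have h0 := h 0 le_rfl
    rw [pow_zero, mul_one] at h0
    rw [pow_zero, mul_one, zero_mul]
    exact FarJoined.refl (by omega)
  | succ m ih =>
    rw [pow_succ, ← mul_assoc, Nat.succ_mul]
    exact (ih fun i hi => h i (by omega)).trans (farJoined_mul hS (h m (by omega)))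

/-- Any two elements far from the identity can be joined by a path of linear length which stays
far from the identity. -/
def LinearlyJoined (S : Set Γ) : Prop :=
  ∃ c C : ℕ, ∀ (n M R : ℕ) (g h : Γ), n ≤ wordLength S g → n ≤ wordLength S h →
    wordLength S g ≤ M → wordLength S h ≤ M → c * (R + 1) ≤ n →
    FarJoined S R (C * (M + 1)) g h

/-- A shortcut between two vertices of a shortest walk would shorten the walk. Translates of these
geodesics centred at a vertex give its escape routes; centred at the identity they give the lower
bound on divergence. -/
theorem exists_geodesic (hS : Subgroup.closure S = ⊤) (hinf : ∀ n, ∃ g : Γ, n ≤ wordLength S g)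
    (n : ℕ) : ∃ f : ℕ → Γ, ∀ i j, i ≤ j → j ≤ n →
      (SimpleGraph.mulCayley S).dist (f i) (f j) = j - i := by
  obtain ⟨g, hg⟩ := hinf n
  obtain ⟨p, hp⟩ := (mulCayley_connected hS).exists_walk_length_eq_dist 1 g
  change p.length = wordLength S g at hp
  have key : ∀ i j, i ≤ j → (SimpleGraph.mulCayley S).dist (p.getVert i) (p.getVert j) ≤ j - i := by
    intro i j hij
    have h1 := SimpleGraph.dist_le ((p.drop i).take (j - i))
    have h2 : (p.drop i).getVert (j - i) = p.getVert j := by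
      rw [SimpleGraph.Walk.drop_getVert, Nat.add_sub_cancel' hij]
    rw [SimpleGraph.Walk.take_length] at h1
    rw [← h2]
    omega
  refine ⟨p.getVert, fun i j hij hj => le_antisymm (key i j hij) ?_⟩
  have h1 := key 0 i (by omega)
  have h2 := key j p.length (by omega)
  rw [SimpleGraph.Walk.getVert_zero] at h1
  rw [SimpleGraph.Walk.getVert_length] at h2
  have h3 := (mulCayley_connected hS).dist_triangle (u := 1) (v := p.getVert i) (w := g)
  have h4 := (mulCayley_connected hS).dist_triangle (u := p.getVert i) (v := p.getVert j) (w := g)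
  have h5 : (SimpleGraph.mulCayley S).dist 1 g = wordLength S g := rfl
  omega

end CayleyGraph

/-! ### Linear divergence -/

section Divergence

variable {Γ : Type*} [Group Γ] {S : Set Γ}

theorem farJoined_of_seq {R N : ℕ} (x : ℕ → Γ)
    (hx : ∀ i < N, (SimpleGraph.mulCayley S).dist (x i) (x (i + 1)) = 1)
    (hR : ∀ i ≤ N, R ≤ wordLength S (x i)) : FarJoined S R N (x 0) (x N) := by
  induction N with
  | zero => exact FarJoined.refl (hR 0 le_rfl)
  | succ N ih =>
    refine (ih (fun i hi => hx i (by omega)) fun i hi => hR i (by omega)).trans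
      ⟨.cons (SimpleGraph.dist_eq_one_iff_adj.1 (hx N (by omega))) .nil, by simp, fun v hv => ?_⟩
    simp only [SimpleGraph.Walk.support_cons, SimpleGraph.Walk.support_nil, List.mem_cons,
      List.not_mem_nil, or_false] at hv
    rcases hv with rfl | rfl
    exacts [hR N (by omega), hR _ le_rfl]

theorem cayley_dist_le_add (hS : Subgroup.closure S = ⊤) (a b : Γ) :
    (SimpleGraph.mulCayley S).dist a b ≤ wordLength S a + wordLength S b := by
  have h1 := (mulCayley_connected hS).dist_triangle (u := a) (v := 1) (w := b)
  rwa [SimpleGraph.dist_comm (u := a) (v := 1)] at h1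

theorem wordLength_le_add_dist (hS : Subgroup.closure S = ⊤) (a b : Γ) :
    wordLength S a ≤ wordLength S b + (SimpleGraph.mulCayley S).dist a b := by
  rw [SimpleGraph.dist_comm]
  exact (mulCayley_connected hS).dist_triangle

/-- In an infinite group, one can go away from any vertex without coming close to the identity. -/
theorem exists_farJoined_escape (hS : Subgroup.closure S = ⊤)
    (hinf : ∀ n, ∃ g : Γ, n ≤ wordLength S g) {n : ℕ} (hn : 1 ≤ n) {g : Γ}
    (hg : wordLength S g = n) (N : ℕ) :
    ∃ g' : Γ, N ≤ wordLength S g' + n ∧ wordLength S g' ≤ N + n ∧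
      FarJoined S (n / 4 + 1) N g g' := by
  -- A geodesic of length `2 * N` is translated so that its midpoint is `g`; one of its two halves
  -- will serve.
  obtain ⟨f, hf⟩ := exists_geodesic hS hinf (2 * N)
  have hx : ∀ i j, i ≤ j → j ≤ 2 * N → (SimpleGraph.mulCayley S).dist
      (g * (f N)⁻¹ * f i) (g * (f N)⁻¹ * f j) = j - i := fun i j hij hj => by
    rw [cayley_dist_mul_left hS, hf i j hij hj]
  generalize hxd : (fun i => g * (f N)⁻¹ * f i) = x
  replace hx : ∀ i j, i ≤ j → j ≤ 2 * N → (SimpleGraph.mulCayley S).dist (x i) (x j) = j - i := by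
    rw [← hxd]; exact hx
  have hxN : x N = g := by rw [← hxd]; simp
  have hx' : ∀ i j, i ≤ j → j ≤ 2 * N →
      (SimpleGraph.mulCayley S).dist (x j) (x i) = j - i := fun i j hij hj => by
    rw [SimpleGraph.dist_comm, hx i j hij hj]
  have hends : ∀ i, (SimpleGraph.mulCayley S).dist g (x i) = N →
      N ≤ wordLength S (x i) + n ∧ wordLength S (x i) ≤ N + n := fun i hi => by
    have h1 := cayley_dist_le_add hS g (x i)
    have h2 := wordLength_le_add_dist hS (x i) g
    rw [SimpleGraph.dist_comm] at h2
    omega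
  by_cases H1 : ∀ t ≤ N, n / 4 + 1 ≤ wordLength S (x (N + t))
  · have hd := hx N (N + N) (by omega) (by omega)
    rw [hxN] at hd
    obtain ⟨h1, h2⟩ := hends (N + N) (by omega)
    refine ⟨x (N + N), h1, h2, ?_⟩
    have := farJoined_of_seq (S := S) (N := N) (fun t => x (N + t))
      (fun i hi => by rw [hx (N + i) (N + (i + 1)) (by omega) (by omega)]; omega) H1
    simpa [hxN] using this
  by_cases H2 : ∀ t ≤ N, n / 4 + 1 ≤ wordLength S (x (N - t))
  · have hd := hx' 0 N (by omega) (by omega)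
    rw [hxN] at hd
    obtain ⟨h1, h2⟩ := hends 0 (by omega)
    refine ⟨x 0, h1, h2, ?_⟩
    have := farJoined_of_seq (S := S) (N := N) (fun t => x (N - t))
      (fun i hi => by rw [hx' (N - (i + 1)) (N - i) (by omega) (by omega)]; omega) H2
    simpa [hxN] using this
  -- If both halves met the ball of radius `n / 4`, the two visits would be at most `n / 2` apart,
  -- although each is at least `3n / 4` from `g` and they lie on opposite sides of it.
  exfalso
  push Not at H1 H2
  obtain ⟨t, ht, h1⟩ := H1
  obtain ⟨t', ht', h2⟩ := H2
  have h3 := cayley_dist_le_add hS (x (N - t')) (x (N + t))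
  rw [hx _ _ (by omega) (by omega)] at h3
  have h4 := wordLength_le_add_dist hS (x N) (x (N + t))
  rw [hx _ _ (by omega) (by omega), hxN] at h4
  have h5 := wordLength_le_add_dist hS (x N) (x (N - t'))
  rw [hx' _ _ (by omega) (by omega), hxN] at h5
  omega

theorem isLinearFunction_divergence (hS : Subgroup.closure S = ⊤)
    (hinf : ∀ n, ∃ g : Γ, n ≤ wordLength S g) (H : LinearlyJoined S) {δ : ℝ} (hδ : δ ≤ 1 / 4) :
    IsLinearFunction (divergence S δ) := by
  obtain ⟨c, C, H⟩ := H
  refine ⟨2 * (3 * c + 1) + C * (3 * c + 3) + 1, fun n hn => ⟨?_, ?_⟩⟩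
  · refine iSup_le fun g => iSup_le fun h => iSup_le fun hg => iSup_le fun hh => ?_
    -- Points at distance `n` may be too close for `H`, which requires `c * (R + 1)`. Escaping by
    -- `(3 * c + 1) * n` leaves distance at least `3 * c * n`, which suffices for `R = n / 4 + 1`.
    obtain ⟨g', g1, g2, g3⟩ := exists_farJoined_escape hS hinf hn hg ((3 * c + 1) * n)
    obtain ⟨h', h1, h2, h3⟩ := exists_farJoined_escape hS hinf hn hh ((3 * c + 1) * n)
    have hc : c * (n / 4 + 1 + 1) ≤ 3 * c * n := by
      rw [mul_comm 3 c, mul_assoc]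
      exact Nat.mul_le_mul_left _ (by omega)
    have e1 : (3 * c + 1) * n = 3 * c * n + n := by ring
    obtain ⟨p, hp, hv⟩ := (g3.trans (H (3 * c * n) ((3 * c + 2) * n) (n / 4 + 1) g' h'
      (by omega) (by omega) (g2.trans (by linarith)) (h2.trans (by linarith)) hc)).trans h3.symm
    refine iInf_le_of_le p (iInf_le_of_le (fun v hvp => ?_) ?_)
    · have h4 : (n / 4 + 1 : ℕ) ≤ (SimpleGraph.mulCayley S).dist 1 v := hv v hvp
      have h5 : (n : ℝ) < 4 * ((SimpleGraph.mulCayley S).dist 1 v : ℝ) := by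
        exact_mod_cast (by omega : n < 4 * (SimpleGraph.mulCayley S).dist 1 v)
      have h6 : δ * n ≤ 1 / 4 * n := by gcongr
      linarith
    · have h4 : C * ((3 * c + 2) * n + 1) ≤ C * ((3 * c + 3) * n) :=
        Nat.mul_le_mul_left _ (by linarith)
      have h5 : p.length ≤ (2 * (3 * c + 1) + C * (3 * c + 3) + 1) * n := by linarith
      exact_mod_cast h5
  -- The ends of a geodesic of length `2 * n` centred at the identity are both at distance `n` from
  -- it, and no path between them is shorter than `2 * n`.
  · have key : (n : ℕ∞) ≤ divergence S δ n := by
      obtain ⟨f, hf⟩ := exists_geodesic hS hinf (2 * n)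
      have hd : ∀ i j, (SimpleGraph.mulCayley S).dist (f i) (f j) =
          (SimpleGraph.mulCayley S).dist ((f n)⁻¹ * f i) ((f n)⁻¹ * f j) := fun i j => by
        rw [cayley_dist_mul_left hS]
      have e1 : (SimpleGraph.mulCayley S).dist 1 ((f n)⁻¹ * f 0) = n := by
        have := hf 0 n (by omega) (by omega)
        rw [hd, inv_mul_cancel, SimpleGraph.dist_comm] at this
        omega
      have e2 : (SimpleGraph.mulCayley S).dist 1 ((f n)⁻¹ * f (2 * n)) = n := by
        have := hf n (2 * n) (by omega) (by omega)
        rw [hd, inv_mul_cancel] at this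
        omega
      have e3 : (SimpleGraph.mulCayley S).dist ((f n)⁻¹ * f 0) ((f n)⁻¹ * f (2 * n)) = 2 * n := by
        have := hf 0 (2 * n) (by omega) (by omega)
        rw [hd] at this
        omega
      unfold divergence
      refine le_iSup_of_le ((f n)⁻¹ * f 0) (le_iSup_of_le ((f n)⁻¹ * f (2 * n))
        (le_iSup_of_le e1 (le_iSup_of_le e2 (le_iInf fun p => le_iInf fun _ => ?_))))
      have := SimpleGraph.dist_le p
      exact_mod_cast (by omega : n ≤ p.length)
    calc (n : ℕ∞) ≤ divergence S δ n := key
      _ = 1 * divergence S δ n := (one_mul _).symm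
      _ ≤ _ := by gcongr; exact_mod_cast Nat.le_add_left _ _

end Divergence

/-! ### Asymptotic cones -/

section Cone

/-- The additive error `B` disappears after rescaling; this absorbs the rounding in discrete paths.
-/
theorem coneDist_le {X : Type*} [PseudoMetricSpace X] {ω : Ultrafilter ℕ} {e : ℕ → X}
    {d : ℕ → ℝ≥0} (hd : Tendsto d ω atTop) (x y : ConeSeq X ω e d) {A B : ℝ}
    (h : ∀ᶠ n in (ω : Filter ℕ), dist (x.1 n) (y.1 n) ≤ A * d n + B) : dist x y ≤ A := by
  have hd' : Tendsto (fun n => (d n : ℝ)) ω atTop := NNReal.tendsto_coe_atTop.2 hd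
  have h1 : Tendsto (fun n => A + B / (d n : ℝ)) ω (𝓝 (A + 0)) :=
    tendsto_const_nhds.add (hd'.const_div_atTop B)
  rw [add_zero] at h1
  refine le_of_tendsto_of_tendsto (tendsto_coneDist x y) h1 ?_
  filter_upwards [h, hd'.eventually_gt_atTop 0] with n hn hpos
  rw [div_le_iff₀ hpos, add_mul, div_mul_cancel₀ _ hpos.ne']
  exact hn

theorem le_coneDist {X : Type*} [PseudoMetricSpace X] {ω : Ultrafilter ℕ} {e : ℕ → X}
    {d : ℕ → ℝ≥0} (hd : Tendsto d ω atTop) (x y : ConeSeq X ω e d) {A : ℝ}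
    (h : ∀ᶠ n in (ω : Filter ℕ), A * d n ≤ dist (x.1 n) (y.1 n)) : A ≤ dist x y := by
  have hd' : Tendsto (fun n => (d n : ℝ)) ω atTop := NNReal.tendsto_coe_atTop.2 hd
  refine ge_of_tendsto (tendsto_coneDist x y) ?_
  filter_upwards [h, hd'.eventually_gt_atTop 0] with n hn hpos
  rwa [le_div_iff₀ hpos]

theorem abs_floor_sub_floor_le (a b : ℝ) :
    |((⌊a⌋₊ : ℕ) : ℝ) - (⌊b⌋₊ : ℕ)| ≤ |a - b| + 1 := by
  wlog h : b ≤ a generalizing a b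
  · rw [abs_sub_comm, abs_sub_comm a b]; exact this b a (le_of_not_ge h)
  have h1 : (⌊b⌋₊ : ℝ) ≤ ⌊a⌋₊ := by exact_mod_cast Nat.floor_mono h
  rw [abs_of_nonneg (by linarith), abs_of_nonneg (by linarith)]
  rcases le_or_gt 0 a with ha | ha
  · linarith [Nat.floor_le ha, Nat.lt_floor_add_one b]
  · rw [Nat.floor_of_nonpos ha.le]
    have : (0 : ℝ) ≤ (⌊b⌋₊ : ℕ) := by positivity
    push_cast
    linarith

/-- Sequences of discrete paths of linear length which avoid balls of linear radius converge to
paths in the asymptotic cone. -/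
theorem exists_isPreconnected_of_paths {X : Type*} [PseudoMetricSpace X] {ω : Ultrafilter ℕ}
    {e : ℕ → X} {d : ℕ → ℝ≥0} (hd : Tendsto d ω atTop) (x y p : ConeSeq X ω e d) {L η : ℝ}
    (hL : 0 ≤ L) (hη : 0 < η) (γ : ℕ → ℕ → X)
    (hγ : ∀ᶠ n in (ω : Filter ℕ), γ n 0 = x.1 n ∧ γ n ⌊L * d n⌋₊ = y.1 n ∧
      (∀ i j, dist (γ n i) (γ n j) ≤ |(i : ℝ) - j|) ∧ ∀ i, η * d n ≤ dist (γ n i) (p.1 n)) :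
    ∃ t ⊆ ({SeparationQuotient.mk p}ᶜ : Set (AsymptoticCone X ω e d)),
      SeparationQuotient.mk x ∈ t ∧ SeparationQuotient.mk y ∈ t ∧ IsPreconnected t := by
  have hd' : Tendsto (fun n => (d n : ℝ)) ω atTop := NNReal.tendsto_coe_atTop.2 hd
  have hmem : ∀ t : ℝ, ∃ C : ℝ, ∀ᶠ n in (ω : Filter ℕ),
      dist (γ n ⌊t * (L * d n)⌋₊) (e n) / (d n : ℝ) ≤ C := by
    intro t
    obtain ⟨C, hC⟩ := x.2
    refine ⟨|t| * L + 1 + C, ?_⟩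
    filter_upwards [hC, hγ, hd'.eventually_ge_atTop 1] with n h1 h2 h3
    have hpos : (0 : ℝ) < d n := by linarith
    rw [div_le_iff₀ hpos] at h1 ⊢
    have h4 := h2.2.2.1 ⌊t * (L * d n)⌋₊ 0
    rw [h2.1] at h4
    have h5 := abs_floor_sub_floor_le (t * (L * d n)) 0
    rw [Nat.floor_zero, sub_zero, abs_mul, abs_of_nonneg (mul_nonneg hL hpos.le)] at h5
    have h6 := dist_triangle (γ n ⌊t * (L * d n)⌋₊) (x.1 n) (e n)
    have h7 := h4.trans h5
    calc dist (γ n ⌊t * (L * d n)⌋₊) (e n) ≤ |t| * (L * d n) + 1 + C * d n := by linarith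
      _ ≤ |t| * (L * d n) + d n + C * d n := by gcongr
      _ = _ := by ring
  -- The limit path, with time rescaled to `[0, 1]`. It is `L`-Lipschitz because taking floors costs
  -- a distance of at most 1 before rescaling.
  let γ' : ℝ → ConeSeq X ω e d := fun t => ⟨fun n => γ n ⌊t * (L * d n)⌋₊, hmem t⟩
  have hcont : Continuous γ' := by
    refine (LipschitzWith.of_dist_le_mul (K := L.toNNReal) fun s t => ?_).continuous
    refine coneDist_le hd _ _ (B := 1) ?_
    filter_upwards [hγ] with n h
    refine (h.2.2.1 _ _).trans ((abs_floor_sub_floor_le _ _).trans ?_)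
    rw [← sub_mul, abs_mul, abs_of_nonneg (mul_nonneg hL (d n).coe_nonneg), Real.dist_eq,
      Real.coe_toNNReal _ hL]
    linarith
  refine ⟨(fun t => SeparationQuotient.mk (γ' t)) '' Set.Icc 0 1, ?_, ⟨0, by simp, ?_⟩,
    ⟨1, by simp, ?_⟩, isPreconnected_Icc.image _
      (SeparationQuotient.continuous_mk.comp hcont).continuousOn⟩
  · rintro _ ⟨t, -, rfl⟩ h0
    rw [Set.mem_singleton_iff, SeparationQuotient.mk_eq_mk, Metric.inseparable_iff] at h0
    have h1 : η ≤ dist (γ' t) p := le_coneDist hd _ _ <| by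
      filter_upwards [hγ] with n h using h.2.2.2 _
    linarith
  · rw [SeparationQuotient.mk_eq_mk, Metric.inseparable_iff]
    refine le_antisymm (coneDist_le hd _ _ (B := 0) ?_) dist_nonneg
    filter_upwards [hγ] with n h
    simp [γ', h.1]
  · rw [SeparationQuotient.mk_eq_mk, Metric.inseparable_iff]
    refine le_antisymm (coneDist_le hd _ _ (B := 0) ?_) dist_nonneg
    filter_upwards [hγ] with n h
    simp [γ', h.2.1]

variable {Γ : Type*} [Group Γ] {S : Set Γ}

theorem FarJoined.exists_seq {R L : ℕ} {g h : Γ} (H : FarJoined S R L g h) :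
    ∃ f : ℕ → Γ, f 0 = g ∧ (∀ i, L ≤ i → f i = h) ∧ (∀ i, R ≤ wordLength S (f i)) ∧
      ∀ i j, ((SimpleGraph.mulCayley S).dist (f i) (f j) : ℝ) ≤ |(i : ℝ) - j| := by
  obtain ⟨p, hp, hR⟩ := H
  refine ⟨p.getVert, p.getVert_zero, fun i hi => p.getVert_of_length_le (hp.trans hi),
    fun i => hR _ (p.getVert_mem_support i), fun i j => ?_⟩
  wlog hij : i ≤ j generalizing i j
  · rw [SimpleGraph.dist_comm, abs_sub_comm]; exact this j i (le_of_not_ge hij)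
  have h1 := SimpleGraph.dist_le ((p.drop i).take (j - i))
  have h2 : (p.drop i).getVert (j - i) = p.getVert j := by
    rw [SimpleGraph.Walk.drop_getVert, Nat.add_sub_cancel' hij]
  rw [SimpleGraph.Walk.take_length] at h1
  have h3 : (i : ℝ) ≤ j := by exact_mod_cast hij
  rw [abs_sub_comm, abs_of_nonneg (by linarith), ← Nat.cast_sub hij, ← h2]
  exact_mod_cast (by omega)

theorem not_hasCutPoint_of_linearlyJoined (hS : Subgroup.closure S = ⊤) (H : LinearlyJoined S)
    (ω : Ultrafilter ℕ) (e : ℕ → CayleyVertices S hS) (d : ℕ → ℝ≥0) (hd : Tendsto d ω atTop) :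
    ¬ HasCutPoint (AsymptoticCone (CayleyVertices S hS) ω e d) := by
  obtain ⟨c, C, H⟩ := H
  rintro ⟨p, hp⟩
  refine hp (isPreconnected_of_forall_pair fun x hx y hy => ?_)
  obtain ⟨p, rfl⟩ := SeparationQuotient.surjective_mk p
  obtain ⟨x, rfl⟩ := SeparationQuotient.surjective_mk x
  obtain ⟨y, rfl⟩ := SeparationQuotient.surjective_mk y
  have hpos : ∀ z : ConeSeq (CayleyVertices S hS) ω e d,
      SeparationQuotient.mk z ∈ ({SeparationQuotient.mk p}ᶜ : Set (AsymptoticCone _ ω e d)) →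
      0 < dist z p := fun z hz => dist_nonneg.lt_of_ne fun h0 =>
    hz ((SeparationQuotient.mk_eq_mk).2 (Metric.inseparable_iff.2 h0.symm))
  set a := dist x p with ha
  set b := dist y p with hb
  have ha0 : 0 < a := hpos x hx
  have hb0 : 0 < b := hpos y hy
  -- For ω-almost all `n`, the distances from `p` lie between `ε * d n` and `D * d n`. The radius
  -- `η` satisfies `c * η ≤ ε / 2`, leaving the other half of `ε` for additive constants.
  set ε := min a b / 2 with hε
  have hε0 : 0 < ε := by positivity
  set D := max a b + 1 with hD
  have hD0 : 0 < D := by positivity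
  set η := ε / (2 * (c + 1)) with hη
  have hη0 : 0 < η := by positivity
  have hcη : c * η ≤ ε / 2 := by
    rw [hη]
    field_simp
    linarith
  have hd' : Tendsto (fun n => (d n : ℝ)) ω atTop := NNReal.tendsto_coe_atTop.2 hd
  have key : ∀ n, ∃ f : ℕ → CayleyVertices S hS,
      (ε * d n ≤ dist (x.1 n) (p.1 n) ∧ ε * d n ≤ dist (y.1 n) (p.1 n) ∧
        dist (x.1 n) (p.1 n) ≤ D * d n ∧ dist (y.1 n) (p.1 n) ≤ D * d n ∧
        1 ≤ (d n : ℝ) ∧ c + 1 ≤ ε / 2 * d n ∧ 1 ≤ η / 2 * d n) →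
      (f 0 = x.1 n ∧ f ⌊(C * (D + 2)) * d n⌋₊ = y.1 n ∧
      (∀ i j, dist (f i) (f j) ≤ |(i : ℝ) - j|) ∧ ∀ i, η / 2 * d n ≤ dist (f i) (p.1 n)) := by
    intro n
    by_cases hn : ε * d n ≤ dist (x.1 n) (p.1 n) ∧ ε * d n ≤ dist (y.1 n) (p.1 n) ∧
        dist (x.1 n) (p.1 n) ≤ D * d n ∧ dist (y.1 n) (p.1 n) ≤ D * d n ∧
        1 ≤ (d n : ℝ) ∧ c + 1 ≤ ε / 2 * d n ∧ 1 ≤ η / 2 * d n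
    swap
    · exact ⟨fun _ => x.1 n, fun h => absurd h hn⟩
    obtain ⟨h1, h2, h3, h4, h5, h6, h7⟩ := hn
    -- Translation by the inverse of `p.1 n` moves the point to be avoided to the identity.
    have hdist : ∀ z : CayleyVertices S hS,
        dist z (p.1 n) = wordLength S ((p.1 n).elt⁻¹ * z.elt) := fun z => by
      rw [dist_comm, ← cayley_dist_eq hS]; rfl
    rw [hdist] at h1 h2 h3 h4
    have hηd : 0 ≤ η * d n := by positivity
    have hεd : 0 ≤ ε * d n := by positivity
    have hDd : 0 ≤ D * d n := by positivity
    have hFJ := H ⌊ε * d n⌋₊ ⌈D * d n⌉₊ ⌊η * d n⌋₊ ((p.1 n).elt⁻¹ * (x.1 n).elt)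
      ((p.1 n).elt⁻¹ * (y.1 n).elt)
      (by exact_mod_cast (Nat.floor_le hεd).trans h1)
      (by exact_mod_cast (Nat.floor_le hεd).trans h2)
      (by exact_mod_cast h3.trans (Nat.le_ceil _)) (by exact_mod_cast h4.trans (Nat.le_ceil _))
      (by
        apply Nat.le_floor
        push_cast
        have h8 : (c : ℝ) * ⌊η * d n⌋₊ ≤ c * (η * d n) := by
          gcongr; exact Nat.floor_le hηd
        nlinarith)
    obtain ⟨f, f1, f2, f3, f4⟩ := hFJ.exists_seq
    refine ⟨fun i => ⟨(p.1 n).elt * f i⟩, fun _ => ⟨?_, ?_, fun i j => ?_, fun i => ?_⟩⟩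
    · simp [f1]
    · dsimp only
      rw [f2]
      · simp
      · apply Nat.le_floor
        push_cast
        have h8 := Nat.ceil_lt_add_one hDd
        rw [mul_assoc]
        gcongr
        nlinarith
    · refine le_trans (le_of_eq ?_) (f4 i j)
      change ((SimpleGraph.mulCayley S).dist _ _ : ℝ) = _
      rw [cayley_dist_mul_left hS]
    · rw [hdist]
      dsimp only
      rw [inv_mul_cancel_left]
      have h8 : ((⌊η * d n⌋₊ : ℕ) : ℝ) ≤ wordLength S (f i) := by exact_mod_cast f3 i
      have h9 := Nat.lt_floor_add_one (η * d n)
      nlinarith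
  choose γ hγ using key
  refine exists_isPreconnected_of_paths hd x y p (L := C * (D + 2)) (η := η / 2) (by positivity)
    (by positivity) γ ?_
  have hx1 := tendsto_coneDist x p
  have hy1 := tendsto_coneDist y p
  have hεa : ε < a := by have := min_le_left a b; linarith
  have hεb : ε < b := by have := min_le_right a b; linarith
  have hDa : a < D := by have := le_max_left a b; linarith
  have hDb : b < D := by have := le_max_right a b; linarith
  filter_upwards [hx1.eventually_const_lt (show ε < coneDist x p from hεa),
    hy1.eventually_const_lt (show ε < coneDist y p from hεb),
    hx1.eventually_lt_const (show coneDist x p < D from hDa),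
    hy1.eventually_lt_const (show coneDist y p < D from hDb),
    hd'.eventually_ge_atTop 1, (hd'.const_mul_atTop (half_pos hε0)).eventually_ge_atTop (c + 1 : ℝ),
    (hd'.const_mul_atTop (half_pos hη0)).eventually_ge_atTop 1] with n h1 h2 h3 h4 h5 h6 h7
  have hdpos : (0 : ℝ) < d n := by linarith
  rw [lt_div_iff₀ hdpos] at h1 h2
  rw [div_lt_iff₀ hdpos] at h3 h4
  exact hγ n ⟨h1.le, h2.le, h3.le, h4.le, h5, h6, h7⟩

end Cone

/-! ### Elements of Thompson groups -/

section Elements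

open ThompsonAux

theorem stream_cons_head_tail (z : CantorSet) : Stream'.cons z.head z.tail = z := Stream'.eta z

/-- The map which acts as `g` on the words starting with `b` and trivially elsewhere. -/
def scaleBit (b : Bool) (g : Equiv.Perm CantorSet) : Equiv.Perm CantorSet where
  toFun z := if z.head = b then Stream'.cons b (g z.tail) else z
  invFun z := if z.head = b then Stream'.cons b (g.symm z.tail) else z
  left_inv z := by
    by_cases h : z.head = b
    · simp only [h, if_true, Stream'.head_cons, Stream'.tail_cons, Equiv.symm_apply_apply]
      rw [← h, stream_cons_head_tail]
    · simp [h]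
  right_inv z := by
    by_cases h : z.head = b
    · simp only [h, if_true, Stream'.head_cons, Stream'.tail_cons, Equiv.apply_symm_apply]
      rw [← h, stream_cons_head_tail]
    · simp [h]

/-- The map which acts as `g` on the cone of the word `a` and trivially elsewhere. -/
def scale : List Bool → Equiv.Perm CantorSet → Equiv.Perm CantorSet
  | [], g => g
  | b :: a, g => scaleBit b (scale a g)

theorem scaleBit_cons (b : Bool) (g : Equiv.Perm CantorSet) (w : CantorSet) :
    scaleBit b g (Stream'.cons b w) = Stream'.cons b (g w) := by
  simp [scaleBit]

theorem scaleBit_cons_not (b : Bool) (g : Equiv.Perm CantorSet) (w : CantorSet) :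
    scaleBit b g (Stream'.cons (!b) w) = Stream'.cons (!b) w := by
  simp [scaleBit]

theorem scale_apply_append (a : List Bool) (g : Equiv.Perm CantorSet) (w : CantorSet) :
    scale a g (a ++ₛ w) = a ++ₛ g w := by
  induction a with
  | nil => rfl
  | cons b a ih => rw [Stream'.cons_append_stream, scale, scaleBit_cons, ih]; rfl

theorem scale_apply_of_forall_ne {a : List Bool} (g : Equiv.Perm CantorSet) {z : CantorSet}
    (h : ∀ w, z ≠ a ++ₛ w) : scale a g z = z := by
  induction a generalizing z with
  | nil => exact absurd rfl (h z)
  | cons b a ih =>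
    rw [← stream_cons_head_tail z] at h ⊢
    rcases Bool.eq_or_eq_not z.head b with hb | hb
    · rw [hb] at h ⊢
      rw [scale, scaleBit_cons, ih fun w hw => h w (by rw [hw]; rfl)]
    · rw [hb, scale, scaleBit_cons_not]

/-- Conjugation transports the support cone. This yields both the commuting elements of the path
construction and the copies of generators deep in the tree. -/
theorem mul_scale_mul_inv {g : Equiv.Perm CantorSet} {a b : List Bool} (hg : TakesBranch g a b)
    (h : Equiv.Perm CantorSet) : g * scale a h * g⁻¹ = scale b h := by
  ext1 z
  simp only [Equiv.Perm.mul_apply]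
  by_cases hz : ∃ w, z = b ++ₛ w
  · obtain ⟨w, rfl⟩ := hz
    rw [takes_inv hg w, scale_apply_append, scale_apply_append, hg]
  · push Not at hz
    rw [scale_apply_of_forall_ne h hz, scale_apply_of_forall_ne]
    · simp
    · intro w hw
      apply hz w
      rw [← hg w, ← hw]
      simp

theorem takes_scaleBit {g : Equiv.Perm CantorSet} {u v : List Bool} (h : TakesBranch g u v)
    (b : Bool) : TakesBranch (scaleBit b g) (b :: u) (b :: v) := fun w => by
  rw [Stream'.cons_append_stream, scaleBit_cons, h]; rfl

theorem takes_scaleBit_not (g : Equiv.Perm CantorSet) (b : Bool) (u : List Bool) :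
    TakesBranch (scaleBit b g) ((!b) :: u) ((!b) :: u) := fun w => by
  rw [Stream'.cons_append_stream, scaleBit_cons_not]

theorem takes_scale {g : Equiv.Perm CantorSet} {u v : List Bool} (h : TakesBranch g u v)
    (a : List Bool) : TakesBranch (scale a g) (a ++ u) (a ++ v) := by
  induction a with
  | nil => exact h
  | cons b a ih => exact takes_scaleBit ih b

/-- `g` takes the words of the first list to the corresponding words of the second. -/
def Carries (g : Equiv.Perm CantorSet) (L M : List (List Bool)) : Prop :=
  List.Forall₂ (TakesBranch g) L M

theorem Carries.map_img {g : Equiv.Perm CantorSet} {L M : List (List Bool)} (h : Carries g L M) :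
    (∀ u ∈ L, TakesBranch g u (img g u)) ∧ L.map (img g) = M := by
  induction h with
  | nil => simp
  | cons h _ ih =>
    refine ⟨fun u hu => ?_, ?_⟩
    · rcases List.mem_cons.1 hu with rfl | hu
      · rw [img_eq h]; exact h
      · exact ih.1 u hu
    · rw [List.map_cons, img_eq h, ih.2]

theorem carries_map_img {g : Equiv.Perm CantorSet} {L : List (List Bool)}
    (h : ∀ u ∈ L, TakesBranch g u (img g u)) : Carries g L (L.map (img g)) := by
  induction L with
  | nil => exact .nil
  | cons u L ih =>
    exact .cons (h u (by simp)) (ih fun v hv => h v (by simp [hv]))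

theorem Carries.inv {g : Equiv.Perm CantorSet} {L M : List (List Bool)} (h : Carries g L M) :
    Carries g⁻¹ M L := by
  induction h with
  | nil => exact .nil
  | cons h _ ih => exact .cons (takes_inv h) ih

theorem Carries.mul {g h : Equiv.Perm CantorSet} {L M N : List (List Bool)} (hg : Carries g L M)
    (hh : Carries h M N) : Carries (h * g) L N := by
  induction hg generalizing N with
  | nil => cases hh; exact .nil
  | cons h1 _ ih =>
    cases hh with
    | cons h2 h3 => exact .cons (takes_mul h1 h2) (ih h3)

theorem Carries.append {g : Equiv.Perm CantorSet} {L M L' M' : List (List Bool)}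
    (h : Carries g L M) (h' : Carries g L' M') : Carries g (L ++ L') (M ++ M') :=
  List.rel_append h h'

theorem Carries.length_eq {g : Equiv.Perm CantorSet} {L M : List (List Bool)}
    (h : Carries g L M) : L.length = M.length := List.Forall₂.length_eq h

theorem carries_map {g : Equiv.Perm CantorSet} {f f' : List Bool → List Bool}
    (L : List (List Bool)) (h : ∀ u, TakesBranch g (f u) (f' u)) :
    Carries g (L.map f) (L.map f') := by
  induction L with
  | nil => exact .nil
  | cons u L ih => exact .cons (h u) ih

theorem Carries.scaleBit {g : Equiv.Perm CantorSet} {L M : List (List Bool)}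
    (h : Carries g L M) (b : Bool) :
    Carries (scaleBit b g) (L.map fun u => b :: u) (M.map fun u => b :: u) := by
  induction h with
  | nil => exact .nil
  | cons h _ ih => exact .cons (takes_scaleBit h b) ih

theorem inClass_iff {R : List (List Bool) → List (List Bool) → Prop}
    {g : Equiv.Perm CantorSet} :
    InClass R g ↔ ∃ (A B : BinTree) (M : List (List Bool)),
      Carries g A.branches M ∧ R M B.branches := by
  constructor
  · rintro ⟨A, B, h, hR⟩
    exact ⟨A, B, _, carries_map_img h, hR⟩
  · rintro ⟨A, B, M, h, hR⟩
    obtain ⟨h1, h2⟩ := h.map_img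
    exact ⟨A, B, h1, by rwa [h2]⟩

theorem mem_thompsonF_iff {g : Equiv.Perm CantorSet} :
    g ∈ thompsonF ↔ ∃ A B : BinTree, Carries g A.branches B.branches := by
  refine (inClass_eq g).symm.trans (inClass_iff.trans ?_)
  constructor
  · rintro ⟨A, B, M, h, rfl⟩; exact ⟨A, B, h⟩
  · rintro ⟨A, B, h⟩; exact ⟨A, B, _, h, rfl⟩

theorem mem_thompsonT_iff {g : Equiv.Perm CantorSet} :
    g ∈ thompsonT ↔ ∃ (A B : BinTree) (M : List (List Bool)),
      Carries g A.branches M ∧ M.IsRotated B.branches :=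
  (inClass_rot g).symm.trans inClass_iff

theorem mem_thompsonV_iff {g : Equiv.Perm CantorSet} :
    g ∈ thompsonV ↔ ∃ (A B : BinTree) (M : List (List Bool)),
      Carries g A.branches M ∧ M.Perm B.branches :=
  (inClass_perm g).symm.trans inClass_iff

theorem thompsonF_le_thompsonT : thompsonF ≤ thompsonT := fun g hg => by
  obtain ⟨A, B, h⟩ := mem_thompsonF_iff.1 hg
  exact mem_thompsonT_iff.2 ⟨A, B, _, h, List.IsRotated.refl _⟩

theorem thompsonT_le_thompsonV : thompsonT ≤ thompsonV := fun g hg => by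
  obtain ⟨A, B, M, h, hM⟩ := mem_thompsonT_iff.1 hg
  exact mem_thompsonV_iff.2 ⟨A, B, M, h, hM.perm⟩

theorem exists_branch_append (A : BinTree) (z : CantorSet) :
    ∃ u ∈ A.branches, ∃ w, z = u ++ₛ w := by
  induction A generalizing z with
  | leaf => exact ⟨[], by simp [BinTree.branches], z, rfl⟩
  | caret l r hl hr =>
    rw [← stream_cons_head_tail z]
    cases z.head
    · obtain ⟨u, hu, w, hw⟩ := hl z.tail
      exact ⟨false :: u, by simp [BinTree.branches, hu], w, by rw [hw]; rfl⟩
    · obtain ⟨u, hu, w, hw⟩ := hr z.tail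
      exact ⟨true :: u, by simp [BinTree.branches, hu], w, by rw [hw]; rfl⟩

/-- The cones of the leaves of `A` cover the Cantor set. -/
theorem Carries.unique {g h : Equiv.Perm CantorSet} {A : BinTree} {M : List (List Bool)}
    (hg : Carries g A.branches M) (hh : Carries h A.branches M) : g = h := by
  have key : ∀ (L : List (List Bool)), Carries g L M → Carries h L M →
      ∀ u ∈ L, ∃ v, TakesBranch g u v ∧ TakesBranch h u v := by
    clear hg hh
    intro L hg hh
    induction hg with
    | nil => simp
    | cons h1 _ ih =>
      cases hh with
      | cons h2 h3 =>
        intro u hu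
        rcases List.mem_cons.1 hu with rfl | hu
        · exact ⟨_, h1, h2⟩
        · exact ih h3 u hu
  ext1 z
  obtain ⟨u, hu, w, rfl⟩ := exists_branch_append A z
  obtain ⟨v, h1, h2⟩ := key _ hg hh u hu
  rw [h1, h2]

/-- The element of `F` which maps `0w` to `00w`, `10w` to `01w` and `11w` to `1w`. -/
def rotateRight : Equiv.Perm CantorSet where
  toFun z := if z.head then (if z.tail.head then z.tail else
    Stream'.cons false (Stream'.cons true z.tail.tail)) else Stream'.cons false z
  invFun z := if z.head then Stream'.cons true z else
    (if z.tail.head then Stream'.cons true (Stream'.cons false z.tail.tail) else z.tail)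
  left_inv z := by
    rw [← stream_cons_head_tail z, ← stream_cons_head_tail z.tail]
    cases z.head <;> cases z.tail.head <;> simp
  right_inv z := by
    rw [← stream_cons_head_tail z, ← stream_cons_head_tail z.tail]
    cases z.head <;> cases z.tail.head <;> simp

theorem takes_rotateRight_zero (u : List Bool) :
    TakesBranch rotateRight (false :: u) (false :: false :: u) := fun w => by
  simp [rotateRight, Stream'.cons_append_stream]

theorem takes_rotateRight_one_zero (u : List Bool) :
    TakesBranch rotateRight (true :: false :: u) (false :: true :: u) := fun w => by
  simp [rotateRight, Stream'.cons_append_stream]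

theorem takes_rotateRight_one_one (u : List Bool) :
    TakesBranch rotateRight (true :: true :: u) (true :: u) := fun w => by
  simp [rotateRight, Stream'.cons_append_stream]

theorem carries_rotateRight (a b c : BinTree) :
    Carries rotateRight (BinTree.caret a (.caret b c)).branches
      (BinTree.caret (.caret a b) c).branches := by
  simp only [BinTree.branches, List.map_append, List.map_map, List.append_assoc]
  exact (carries_map _ takes_rotateRight_zero).append
    ((carries_map _ takes_rotateRight_one_zero).append (carries_map _ takes_rotateRight_one_one))

theorem rotateRight_mem : rotateRight ∈ thompsonF :=
  mem_thompsonF_iff.2 ⟨_, _, carries_rotateRight .leaf .leaf .leaf⟩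

theorem scaleBit_mem_thompsonF {g : Equiv.Perm CantorSet} (hg : g ∈ thompsonF) (b : Bool) :
    scaleBit b g ∈ thompsonF := by
  obtain ⟨A, B, h⟩ := mem_thompsonF_iff.1 hg
  have h0 : Carries (scaleBit b g) [[!b]] [[!b]] := .cons (takes_scaleBit_not g b []) .nil
  cases b
  · exact mem_thompsonF_iff.2 ⟨.caret A .leaf, .caret B .leaf, (h.scaleBit false).append h0⟩
  · exact mem_thompsonF_iff.2 ⟨.caret .leaf A, .caret .leaf B, h0.append (h.scaleBit true)⟩

end Elements

/-! ### Paths in Thompson groups -/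

section Paths

open ThompsonAux

/-! ### Distortion of branches as a lower bound for word length -/

/-- `g` takes every branch of length at least `N` to a branch, changing its length by at most
`N`. -/
def TakesDeep (g : Equiv.Perm CantorSet) (N : ℕ) : Prop :=
  ∀ a : List Bool, N ≤ a.length →
    ∃ b, TakesBranch g a b ∧ a.length ≤ b.length + N ∧ b.length ≤ a.length + N

theorem TakesDeep.mul {g h : Equiv.Perm CantorSet} {n m : ℕ} (hg : TakesDeep g n)
    (hh : TakesDeep h m) : TakesDeep (g * h) (n + m) := fun a ha => by
  obtain ⟨b, h1, h2, h3⟩ := hh a (by omega)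
  obtain ⟨c, h4, h5, h6⟩ := hg b (by omega)
  exact ⟨c, takes_mul h1 h4, by omega, by omega⟩

theorem takesDeep_one : TakesDeep 1 0 := fun a _ => ⟨a, fun _ => rfl, by simp, by simp⟩

/-- Appending `N` zeros to both words makes the branch deep enough without changing the difference
of lengths. -/
theorem TakesDeep.length_le {g : Equiv.Perm CantorSet} {N : ℕ} (hg : TakesDeep g N)
    {a b : List Bool} (h : TakesBranch g a b) :
    a.length ≤ b.length + N ∧ b.length ≤ a.length + N := by
  obtain ⟨c, h1, h2, h3⟩ := hg (a ++ List.replicate N false) (by simp)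
  have h4 := takes_append h (List.replicate N false)
  obtain rfl := append_unique _ _ fun w => (h1 w).symm.trans (h4 w)
  simp only [List.length_append, List.length_replicate] at h2 h3
  omega

theorem exists_prefix_mem_branches (A : BinTree) :
    ∃ N, ∀ a : List Bool, N ≤ a.length → ∃ u ∈ A.branches, ∃ x, a = u ++ x := by
  induction A with
  | leaf => exact ⟨0, fun a _ => ⟨[], by simp [BinTree.branches], a, rfl⟩⟩
  | caret l r hl hr =>
    obtain ⟨n, hn⟩ := hl
    obtain ⟨m, hm⟩ := hr
    refine ⟨n + m + 1, fun a ha => ?_⟩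
    match a, ha with
    | false :: a, ha =>
      obtain ⟨u, hu, x, rfl⟩ := hn a (by rw [List.length_cons] at ha; omega)
      exact ⟨false :: u, by simp [BinTree.branches, hu], x, rfl⟩
    | true :: a, ha =>
      obtain ⟨u, hu, x, rfl⟩ := hm a (by rw [List.length_cons] at ha; omega)
      exact ⟨true :: u, by simp [BinTree.branches, hu], x, rfl⟩

theorem exists_takesDeep {g : Equiv.Perm CantorSet} (hg : g ∈ thompsonV) :
    ∃ N, ∀ n, N ≤ n → TakesDeep g n := by
  obtain ⟨A, B, h1, -⟩ := (inClass_perm g).2 hg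
  obtain ⟨N, hN⟩ := exists_prefix_mem_branches A
  refine ⟨N + A.branches.toFinset.sup List.length +
    A.branches.toFinset.sup fun u => (img g u).length, fun n hn a ha => ?_⟩
  obtain ⟨u, hu, x, rfl⟩ := hN a (by omega)
  have h2 := Finset.le_sup (f := List.length) (List.mem_toFinset.2 hu)
  have h3 := Finset.le_sup (f := fun u => (img g u).length) (List.mem_toFinset.2 hu)
  refine ⟨img g u ++ x, takes_append (h1 u hu) x, ?_, ?_⟩ <;>
  · simp only [List.length_append] at *
    omega

/-- Near the fixed point c s s s … each application of `g` inserts one more letter `s`, so powers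
have linearly growing distortion. -/
theorem takes_pow {g : Equiv.Perm CantorSet} {c : List Bool} {s : Bool}
    (h : TakesBranch g (c ++ [s]) (c ++ [s, s])) (i : ℕ) :
    TakesBranch (g ^ i) (c ++ [s]) (c ++ List.replicate (i + 1) s) := by
  induction i with
  | zero => exact fun w => rfl
  | succ i ih =>
    rw [pow_succ']
    refine takes_mul ih ?_
    have := takes_append h (List.replicate i s)
    simpa [List.replicate_succ] using this

theorem takes_pow_self {g : Equiv.Perm CantorSet} {c : List Bool} (h : TakesBranch g c c) (i : ℕ) :
    TakesBranch (g ^ i) c c := by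
  induction i with
  | zero => exact fun w => rfl
  | succ i ih => rw [pow_succ']; exact takes_mul ih h

theorem takes_scale_rotateRight (a : List Bool) :
    TakesBranch (scale a rotateRight) (a ++ [false]) (a ++ [false, false]) :=
  takes_scale (takes_rotateRight_zero []) a

variable {G : Subgroup (Equiv.Perm CantorSet)} {S : Set G}

theorem exists_takesDeep_wordLength (hV : G ≤ thompsonV) (hfin : S.Finite)
    (hS : Subgroup.closure S = ⊤) :
    ∃ κ : ℕ, 1 ≤ κ ∧ ∀ g : G, TakesDeep (g : Equiv.Perm CantorSet) (κ * wordLength S g) := by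
  have h1 : ∀ g : G, ∃ N, ∀ n, N ≤ n → TakesDeep (g : Equiv.Perm CantorSet) n :=
    fun g => exists_takesDeep (hV g.2)
  choose N hN using h1
  -- The summand 1 makes `κ` positive, so that it can be cancelled from inequalities later.
  refine ⟨1 + hfin.toFinset.sup (fun s => N s + N s⁻¹), by omega, fun g => ?_⟩
  refine wordLength_induction hS (P := fun g n => TakesDeep (g : Equiv.Perm CantorSet) n)
    takesDeep_one (fun h1 h2 => h1.mul h2) (fun s hs => ?_) g
  have h2 := Finset.le_sup (f := fun s => N s + N s⁻¹) (hfin.mem_toFinset.2 hs)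
  exact ⟨hN s _ (by omega), hN s⁻¹ _ (by omega)⟩

theorem le_mul_wordLength {κ : ℕ}
    (hκ : ∀ g : G, TakesDeep (g : Equiv.Perm CantorSet) (κ * wordLength S g)) {g : G} {i : ℕ}
    {a b : List Bool} (h : TakesBranch (g : Equiv.Perm CantorSet) a b)
    (hi : a.length + i ≤ b.length ∨ b.length + i ≤ a.length) : i ≤ κ * wordLength S g := by
  have := (hκ g).length_le h
  omega

/-- Undoing `z ^ i` costs at most `i * μ`, and `i` is itself at most `κ` times the length of `g * z
^ i`. -/
theorem wordLength_le_of_pow (hS : Subgroup.closure S = ⊤) {κ μ : ℕ} {g z : G}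
    (hz : wordLength S z ≤ μ) (h : ∀ i, i ≤ κ * wordLength S (g * z ^ i)) (i : ℕ) :
    wordLength S g ≤ (1 + κ * μ) * wordLength S (g * z ^ i) := by
  have h1 := wordLength_le_mul_add hS g (z ^ i)
  have h2 := wordLength_pow_le hS z i
  have h3 : i * wordLength S z ≤ κ * wordLength S (g * z ^ i) * μ := Nat.mul_le_mul (h i) hz
  linarith

/-- Multiplying by powers of an element which expands a neighbourhood of a point leads away from
the identity. -/
theorem farJoined_of_expanding (hS : Subgroup.closure S = ⊤) {κ μ R : ℕ} {g z : G}
    (hz : wordLength S z ≤ μ) (h : ∀ i, i ≤ κ * wordLength S (g * z ^ i))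
    (hg : (1 + κ * μ) * (R + μ) ≤ wordLength S g) (m : ℕ) :
    FarJoined S R (m * μ) g (g * z ^ m) := by
  refine (farJoined_pow hS fun i _ => ?_).mono le_rfl (Nat.mul_le_mul_left m hz)
  have h1 := hg.trans (wordLength_le_of_pow hS hz h i)
  have h2 := Nat.le_of_mul_le_mul_left h1 (by omega)
  omega

/-- The image of a long word of zeros is either at least as long or shorter. Powers of `y` lengthen
the image further in the first case; powers of `y⁻¹` allow a longer source for the same image in the
second. The letter `s` records the end of the Cantor set at which `z` lengthens branches. -/
theorem exists_expanding {κ : ℕ}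
    (hκ : ∀ g : G, TakesDeep (g : Equiv.Perm CantorSet) (κ * wordLength S g)) {y : G}
    (hy : (y : Equiv.Perm CantorSet) = rotateRight) (g : G) :
    ∃ (z : G) (s : Bool), (z = y ∨ z = y⁻¹) ∧
      TakesBranch (z : Equiv.Perm CantorSet) [s] [s, s] ∧
      ∀ i, i ≤ κ * wordLength S (g * z ^ i) := by
  have hy0 : TakesBranch (y : Equiv.Perm CantorSet) [false] [false, false] := by
    rw [hy]; exact takes_rotateRight_zero []
  have hy1 : TakesBranch ((y⁻¹ : G) : Equiv.Perm CantorSet) [true] [true, true] := by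
    rw [Subgroup.coe_inv, hy]; exact takes_inv (takes_rotateRight_one_one [])
  generalize hK : κ * wordLength S g = K
  obtain ⟨b, hb, -, -⟩ := hκ g (List.replicate (K + 1) false) (by simp [hK])
  have hyi : ∀ i : ℕ, TakesBranch ((y : Equiv.Perm CantorSet) ^ i) (List.replicate (K + 1) false)
      (List.replicate (K + 1) false ++ List.replicate i false) := fun i => by
    have := takes_append (takes_pow (c := []) hy0 i) (List.replicate K false)
    rw [List.nil_append, List.nil_append, ← List.replicate_add] at this
    rw [← List.replicate_add, show K + 1 + i = i + 1 + K by omega]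
    exact this
  by_cases hbK : K + 1 ≤ b.length
  · refine ⟨y, false, .inl rfl, hy0, fun i => ?_⟩
    refine le_mul_wordLength hκ (a := List.replicate (K + 1) false)
      (b := b ++ List.replicate i false) ?_ (.inl ?_)
    · rw [Subgroup.coe_mul, Subgroup.coe_pow]
      exact takes_mul (hyi i) (takes_append hb _)
    · simp; omega
  · refine ⟨y⁻¹, true, .inr rfl, hy1, fun i => ?_⟩
    refine le_mul_wordLength hκ (a := List.replicate (K + 1) false ++ List.replicate i false)
      (b := b) ?_ (.inr ?_)
    · rw [Subgroup.coe_mul, Subgroup.coe_pow, Subgroup.coe_inv, inv_pow]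
      exact takes_mul (takes_inv (hyi i)) hb
    · simp; omega

/-- An element `g * u ^ m`, where `u` is supported on a cone which `g` takes to a cone other than
the whole Cantor set, can be joined with a power of an element with disjoint support. -/
theorem farJoined_pow_of_takes (hS : Subgroup.closure S = ⊤) {κ μ M R m : ℕ} (hκ1 : 1 ≤ κ)
    (hκ : ∀ g : G, TakesDeep (g : Equiv.Perm CantorSet) (κ * wordLength S g))
    (U : Bool → G) (hU : ∀ s, (U s : Equiv.Perm CantorSet) = scale [s] rotateRight)
    (hμ : ∀ s, wordLength S (U s) ≤ μ) {g : G} {s j : Bool} {b : List Bool}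
    (hg : TakesBranch (g : Equiv.Perm CantorSet) [s] (j :: b)) (hM : wordLength S g ≤ M)
    (hm : κ * (M + R + μ) ≤ m) :
    FarJoined S R (3 * M + 2 * (m * μ)) (g * U s ^ m) (U (!j) ^ m) := by
  set u := U s with hu
  set v := U (!j) with hv
  set q := g * u * g⁻¹ with hq
  have hqb : (q : Equiv.Perm CantorSet) = scale (j :: b) rotateRight := by
    rw [hq, Subgroup.coe_mul, Subgroup.coe_mul, Subgroup.coe_inv, hu, hU, mul_scale_mul_inv hg]
  have hv1 : TakesBranch (v : Equiv.Perm CantorSet) [j] [j] := by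
    have := takes_scaleBit_not rotateRight (!j) []
    rw [Bool.not_not] at this
    rw [hv, hU]
    exact this
  -- `v` fixes the cone of `j` pointwise, so conjugation by it preserves the scaled map `q` inside
  -- that cone.
  have hcomm : Commute v q := by
    rw [commute_iff_eq, ← mul_inv_eq_iff_eq_mul]
    apply Subtype.ext
    rw [Subgroup.coe_mul, Subgroup.coe_mul, Subgroup.coe_inv, hqb]
    exact mul_scale_mul_inv (takes_append hv1 b) _
  have hqi : ∀ i, q ^ i * g = g * u ^ i := fun i => by
    rw [hq, conj_pow]; group
  have hlarge : ∀ {x : G}, m ≤ κ * wordLength S x → M + R + μ ≤ wordLength S x :=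
    fun hx => Nat.le_of_mul_le_mul_left (hm.trans hx) hκ1
  -- Powers of `v` do not move the cone on which `q ^ m` has distortion `m`; `h2` is the same with
  -- the roles exchanged. In the margin `M + R + μ`, the term `M` pays for multiplying by `g` and
  -- `μ` for one step by `u` or `v`.
  have h1 : ∀ i, M + R + μ ≤ wordLength S (q ^ m * v ^ i) := fun i => hlarge <| by
    refine le_mul_wordLength hκ (a := (j :: b) ++ [false])
      (b := (j :: b) ++ List.replicate (m + 1) false) ?_ (.inl ?_)
    · rw [Subgroup.coe_mul, Subgroup.coe_pow, Subgroup.coe_pow]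
      refine takes_mul (takes_append (takes_pow_self hv1 i) _) ?_
      rw [hqb]
      exact takes_pow (takes_scale_rotateRight _) m
    · simp only [List.length_append, List.length_cons, List.length_replicate, List.length_nil]
      omega
  have h2 : ∀ i, M + R + μ ≤ wordLength S (v ^ m * q ^ i) := fun i => hlarge <| by
    refine le_mul_wordLength hκ (a := [!j] ++ [false])
      (b := [!j] ++ List.replicate (m + 1) false) ?_ (.inl ?_)
    · rw [Subgroup.coe_mul, Subgroup.coe_pow, Subgroup.coe_pow]
      refine takes_mul (takes_pow_self ?_ i) ?_
      · rw [hqb]; exact takes_scaleBit_not _ j _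
      · rw [hv, hU]; exact takes_pow (takes_scale_rotateRight _) m
    · simp only [List.length_append, List.length_cons, List.length_replicate, List.length_nil]
      omega
  have h3 : FarJoined S R M (g * u ^ m) (q ^ m) := by
    have h4 := h1 0
    rw [pow_zero, mul_one] at h4
    rw [← hqi]
    exact (farJoined_mul hS (by omega)).symm.mono le_rfl hM
  have h4 : FarJoined S R (m * μ) (q ^ m) (q ^ m * v ^ m) := by
    refine (farJoined_pow hS fun i _ => ?_).mono le_rfl (Nat.mul_le_mul_left m (hμ _))
    have h4 := h1 i
    have h5 : wordLength S v ≤ μ := hμ _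
    omega
  have h5 : FarJoined S R M (q ^ m * v ^ m) (v ^ m * q ^ m * g) := by
    rw [(hcomm.pow_pow m m).eq.symm]
    have h5 := h2 m
    exact (farJoined_mul hS (by omega)).mono le_rfl hM
  -- Since `q ^ i * g = g * u ^ i`, changing the power of `q` to the left of `g` is a walk by right
  -- multiplications with `u`.
  have h6 : FarJoined S R (m * μ) (v ^ m * g) (v ^ m * q ^ m * g) := by
    rw [mul_assoc (v ^ m), hqi, ← mul_assoc]
    refine (farJoined_pow hS fun i _ => ?_).mono le_rfl (Nat.mul_le_mul_left m (hμ s))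
    have h6 := h2 i
    have h7 := wordLength_le_mul_add hS (v ^ m * q ^ i) g
    rw [mul_assoc (v ^ m), hqi, ← mul_assoc] at h7
    have h8 : wordLength S u ≤ μ := hμ _
    omega
  have h7 : FarJoined S R M (v ^ m) (v ^ m * g) := by
    have h7 := h2 0
    rw [pow_zero, mul_one] at h7
    exact (farJoined_mul hS (by omega)).mono le_rfl hM
  exact ((((h3.trans h4).trans h5).trans h6.symm).trans h7.symm).mono le_rfl (by omega)

/-- Every element far from the identity can be joined with a power of one of two elements. -/
theorem exists_farJoined_pow (hS : Subgroup.closure S = ⊤) {κ μ M R m : ℕ} (hκ1 : 1 ≤ κ)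
    (hκ : ∀ g : G, TakesDeep (g : Equiv.Perm CantorSet) (κ * wordLength S g))
    {y : G} (hy : (y : Equiv.Perm CantorSet) = rotateRight) (hyμ : wordLength S y ≤ μ)
    (U : Bool → G) (hU : ∀ s, (U s : Equiv.Perm CantorSet) = scale [s] rotateRight)
    (hμ : ∀ s, wordLength S (U s) ≤ μ) (g : G) (hM : wordLength S g ≤ M)
    (hR : (1 + κ * μ) * ((1 + κ * μ) * (R + μ)) ≤ wordLength S g)
    (hm : κ * ((1 + κ * μ) * M + R + μ) ≤ m) :
    ∃ j, FarJoined S R (κ * M * μ + m * μ + (3 * ((1 + κ * μ) * M) + 2 * (m * μ))) g (U j ^ m) := by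
  obtain ⟨z, s, hz, hzs, hi⟩ := exists_expanding hκ hy g
  have hzμ : wordLength S z ≤ μ := by
    rcases hz with rfl | rfl
    · exact hyμ
    · rwa [wordLength_inv hS]
  have hA : 1 ≤ 1 + κ * μ := by omega
  have h1 := farJoined_of_expanding hS (R := R) hzμ hi
    ((Nat.le_mul_of_pos_left _ hA).trans hR) (κ * M)
  set g' := g * z ^ (κ * M) with hg'
  have hg'R : (1 + κ * μ) * (R + μ) ≤ wordLength S g' :=
    Nat.le_of_mul_le_mul_left (hR.trans (wordLength_le_of_pow hS hzμ hi (κ * M))) hA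
  have hg'M : wordLength S g' ≤ (1 + κ * μ) * M := by
    have h2 := wordLength_mul_le hS g (z ^ (κ * M))
    have h3 := (wordLength_pow_le hS z (κ * M)).trans (Nat.mul_le_mul_left (κ * M) hzμ)
    linarith
  -- `z ^ (κ * M)` takes `[s]` to a word of length `κ * M + 1`, which `g` shortens by at most `κ *
  -- M`. Hence the image is a proper cone, with a complementary half free for a commuting element.
  obtain ⟨b, hb, hb1⟩ : ∃ b, TakesBranch (g' : Equiv.Perm CantorSet) [s] b ∧ 1 ≤ b.length := by
    have hle : κ * wordLength S g ≤ κ * M := Nat.mul_le_mul_left κ hM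
    obtain ⟨b, h2, h3, -⟩ := hκ g (List.replicate (κ * M + 1) s) (by simp; omega)
    refine ⟨b, ?_, by rw [List.length_replicate] at h3; omega⟩
    rw [hg', Subgroup.coe_mul, Subgroup.coe_pow]
    exact takes_mul (takes_pow (c := []) hzs _) h2
  -- `U s` also expands along `g'`, because `b` is at least as long as `[s]`. This second expanding
  -- stretch accounts for the second factor `1 + κ * μ` in `hR`.
  have h2 := farJoined_of_expanding hS (κ := κ) (R := R) (g := g') (hμ s) (fun i => by
    refine le_mul_wordLength hκ (a := [s] ++ [false])
      (b := b ++ List.replicate (i + 1) false) ?_ (.inl ?_)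
    · rw [Subgroup.coe_mul, Subgroup.coe_pow, hU]
      exact takes_mul (takes_pow (takes_scale_rotateRight _) i) (takes_append hb _)
    · simp only [List.length_append, List.length_cons, List.length_replicate, List.length_nil]
      omega) hg'R m
  match b, hb, hb1 with
  | j :: b, hb, _ =>
    exact ⟨!j, (h1.trans h2).trans (farJoined_pow_of_takes hS hκ1 hκ U hU hμ hb hg'M hm)⟩

theorem linearlyJoined_of_between (hF : thompsonF ≤ G) (hV : G ≤ thompsonV) (hfin : S.Finite)
    (hS : Subgroup.closure S = ⊤) :
    LinearlyJoined S ∧ ∀ n, ∃ g : G, n ≤ wordLength S g := by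
  obtain ⟨κ, hκ1, hκ⟩ := exists_takesDeep_wordLength hV hfin hS
  obtain ⟨y, hy⟩ : ∃ y : G, (y : Equiv.Perm CantorSet) = rotateRight :=
    ⟨⟨_, hF rotateRight_mem⟩, rfl⟩
  obtain ⟨U, hU⟩ : ∃ U : Bool → G, ∀ s, (U s : Equiv.Perm CantorSet) = scale [s] rotateRight :=
    ⟨fun s => ⟨_, hF (scaleBit_mem_thompsonF rotateRight_mem s)⟩, fun s => rfl⟩
  constructor
  swap
  · intro n
    refine ⟨y ^ (κ * n), ?_⟩
    have h1 : κ * n ≤ κ * wordLength S (y ^ (κ * n)) := by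
      refine le_mul_wordLength hκ (a := [false]) (b := List.replicate (κ * n + 1) false) ?_
        (.inl (by simp; omega))
      rw [Subgroup.coe_pow, hy]
      exact takes_pow (c := []) (takes_rotateRight_zero []) _
    exact Nat.le_of_mul_le_mul_left h1 hκ1
  obtain ⟨μ, hyμ, hμ⟩ : ∃ μ, wordLength S y ≤ μ ∧ ∀ s, wordLength S (U s) ≤ μ :=
    ⟨wordLength S y + wordLength S (U false) + wordLength S (U true), by omega, fun s => by
      cases s <;> omega⟩
  generalize hA : 1 + κ * μ = A
  have hA1 : 1 ≤ A := by omega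
  -- The first constant allows for the loss of a factor `A` in each of two expanding stretches. The
  -- second adds up two paths to powers of `U` and one path between these powers, with `m` linear in
  -- `M` because `R ≤ M`.
  refine ⟨A * A * (1 + μ), 9 * A + 2 * κ * μ + 8 * (κ * (A + 1 + μ)) * μ,
    fun n M R g h hng hnh hgM hhM hR => ?_⟩
  have hR' : A * (A * (R + μ)) ≤ n := by
    refine le_trans ?_ hR
    have h1 : R + μ ≤ (1 + μ) * (R + 1) := by nlinarith
    calc A * (A * (R + μ)) ≤ A * (A * ((1 + μ) * (R + 1))) := by gcongr
      _ = _ := by ring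
  have hRM : R ≤ M := by
    have h1 : R ≤ A * (A * (R + μ)) := by
      calc R ≤ 1 * (1 * (R + μ)) := by omega
        _ ≤ _ := by gcongr
    omega
  generalize hm : κ * (A * M + R + μ) = m
  have hmle : m ≤ κ * (A + 1 + μ) * (M + 1) := by
    rw [← hm, mul_assoc]
    gcongr
    nlinarith
  have key : ∀ g : G, wordLength S g ≤ M → n ≤ wordLength S g →
      ∃ j, FarJoined S R (κ * M * μ + m * μ + (3 * (A * M) + 2 * (m * μ))) g (U j ^ m) := by
    intro g h1 h2
    have := exists_farJoined_pow hS (R := R) (m := m) hκ1 hκ hy hyμ U hU hμ g h1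
      (by rw [hA]; omega) (by rw [hA]; omega)
    rwa [hA] at this
  obtain ⟨j, hj⟩ := key g hgM hng
  obtain ⟨k, hk⟩ := key h hhM hnh
  -- With `g = 1`, the commutation path joins the powers supported on the two halves.
  have hjk : FarJoined S R (3 * (A * M) + 2 * (m * μ)) (U j ^ m) (U k ^ m) := by
    have h1 := farJoined_pow_of_takes hS (M := A * M) (R := R) (m := m) hκ1 hκ U hU hμ (g := 1)
      (s := j) (j := j) (b := []) (fun w => rfl) (by simp [wordLength_one]) hm.le
    rw [one_mul] at h1
    rcases Bool.eq_or_eq_not k j with rfl | rfl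
    · obtain ⟨p, -, hp⟩ := h1
      exact (FarJoined.refl (hp _ p.start_mem_support)).mono le_rfl (Nat.zero_le _)
    · exact h1
  refine ((hj.trans hjk).trans hk.symm).mono le_rfl ?_
  have h1 : m * μ ≤ κ * (A + 1 + μ) * (M + 1) * μ := Nat.mul_le_mul_right μ hmle
  have h2 : (9 * A + 2 * κ * μ + 8 * (κ * (A + 1 + μ)) * μ) * (M + 1) =
    9 * (A * M) + 9 * A + 2 * (κ * M * μ) + 2 * κ * μ + 8 * (κ * (A + 1 + μ) * (M + 1) * μ) := by
    ring
  rw [h2]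
  omega

end Paths

/-! ### Finite generation -/

section Generation

open ThompsonAux

/-- The tree with a right spine of `k` carets whose left leaves are leaves of the tree, and the
tree `A` attached at the end of the spine. -/
def spine : ℕ → BinTree → BinTree
  | 0, A => A
  | k + 1, A => .caret .leaf (spine k A)

/-- The branches `0`, `10`, ..., `1 ⋯ 10` of the first `k` leaves of `spine k A`. -/
def spineBranches : ℕ → List (List Bool)
  | 0 => []
  | k + 1 => [false] :: (spineBranches k).map fun u => true :: u

theorem spine_succ (k : ℕ) (A : BinTree) : spine (k + 1) A = spine k (.caret .leaf A) := by
  induction k with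
  | zero => rfl
  | succ k ih => rw [spine, ih]; rfl

theorem spine_add (k m : ℕ) (A : BinTree) : spine (k + m) A = spine k (spine m A) := by
  induction k with
  | zero => rw [Nat.zero_add]; rfl
  | succ k ih => rw [Nat.succ_add, spine, ih]; rfl

theorem branches_spine (k : ℕ) (A : BinTree) : (spine k A).branches =
    spineBranches k ++ A.branches.map fun u => List.replicate k true ++ u := by
  induction k with
  | zero => simp [spine, spineBranches]
  | succ k ih =>
    rw [spine, BinTree.branches, ih, spineBranches]
    simp [BinTree.branches, List.replicate_succ]

theorem length_spineBranches (k : ℕ) : (spineBranches k).length = k := by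
  induction k with
  | zero => rfl
  | succ k ih => simp [spineBranches, ih]

theorem spineBranches_succ (k : ℕ) :
    spineBranches (k + 1) = spineBranches k ++ [List.replicate k true ++ [false]] := by
  induction k with
  | zero => rfl
  | succ k ih =>
    conv_rhs => rw [spineBranches]
    rw [spineBranches, ih]
    simp [List.replicate_succ]

theorem length_branches_spine_leaf (n : ℕ) : (spine n .leaf).branches.length = n + 1 := by
  rw [branches_spine]
  simp [BinTree.branches, length_spineBranches]

theorem Carries.scale_spine {g : Equiv.Perm CantorSet} {L M : List (List Bool)}
    (h : Carries g L M) (k : ℕ) :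
    Carries (scale (List.replicate k true) g)
      (spineBranches k ++ L.map fun u => List.replicate k true ++ u)
      (spineBranches k ++ M.map fun u => List.replicate k true ++ u) := by
  induction k with
  | zero => simpa [spineBranches, scale] using h
  | succ k ih =>
    have h1 : Carries (scale (List.replicate (k + 1) true) g) [[false]] [[false]] :=
      .cons (takes_scaleBit_not _ true []) .nil
    have h2 := h1.append (ih.scaleBit true)
    simpa [spineBranches, List.replicate_succ, Function.comp_def] using h2

theorem Carries.exists_of_append_right {g : Equiv.Perm CantorSet} {L M N : List (List Bool)}
    (h : Carries g L (M ++ N)) : ∃ M' N', L = M' ++ N' ∧ Carries g M' M ∧ Carries g N' N := by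
  induction M generalizing L with
  | nil => exact ⟨[], L, rfl, .nil, h⟩
  | cons v M ih =>
    cases h with
    | @cons u _ L _ h1 h2 =>
      obtain ⟨M', N', rfl, h3, h4⟩ := ih h2
      exact ⟨u :: M', N', rfl, .cons h1 h3, h4⟩

theorem Carries.rotate {g : Equiv.Perm CantorSet} {L M : List (List Bool)} (h : Carries g L M)
    (k : ℕ) : Carries g (L.rotate k) (M.rotate k) := by
  induction k generalizing L M with
  | zero => simpa using h
  | succ k ih =>
    cases h with
    | nil => simpa using Carries.inv (g := g⁻¹) .nil
    | cons h1 h2 =>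
      rw [List.rotate_cons_succ, List.rotate_cons_succ]
      exact ih (Carries.append h2 (.cons h1 .nil))

variable {H : Subgroup (Equiv.Perm CantorSet)}

/-- Conjugation by `rotateRight⁻¹` moves the cone of 1 ⋯ 1 one level deeper. It starts only from a
nonempty word, hence two initial hypotheses. -/
theorem scale_replicate_mem (hr : rotateRight ∈ H) {g : Equiv.Perm CantorSet} (h0 : g ∈ H)
    (h1 : scale [true] g ∈ H) (k : ℕ) : scale (List.replicate k true) g ∈ H := by
  match k with
  | 0 => exact h0
  | 1 => exact h1
  | k + 2 =>
    have h2 := scale_replicate_mem hr h0 h1 (k + 1)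
    rw [List.replicate_succ, List.replicate_succ,
      ← mul_scale_mul_inv (takes_inv (takes_rotateRight_one_one (List.replicate k true)))]
    exact mul_mem (mul_mem (inv_mem hr) h2) (inv_mem (inv_mem hr))

/-- A measure of how far a tree is from having no left carets. -/
def BinTree.leftWeight : BinTree → ℕ
  | .leaf => 0
  | .caret l r => 2 * l.leftWeight + r.leftWeight + 1

/-- Rotations along the right spine transform every tree into one which is just a spine. -/
theorem exists_carries_spine (hr : rotateRight ∈ H) (hr1 : scale [true] rotateRight ∈ H)
    (A : BinTree) (k : ℕ) : ∃ h ∈ H, ∃ n,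
      Carries h (spine k A).branches (spine n .leaf).branches := by
  match A with
  | .leaf =>
    refine ⟨1, H.one_mem, k, ?_⟩
    simpa using carries_map (g := 1) (f := id) (f' := id) _ fun u w => rfl
  | .caret .leaf r =>
    rw [← spine_succ]
    exact exists_carries_spine hr hr1 r (k + 1)
  -- Undoing a rotation moves a caret from the left subtree to the right; the doubled weight of left
  -- subtrees makes `leftWeight` drop.
  | .caret (.caret a b) c =>
    obtain ⟨h, hh, n, hn⟩ := exists_carries_spine hr hr1 (.caret a (.caret b c)) k
    refine ⟨h * (scale (List.replicate k true) rotateRight)⁻¹,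
      mul_mem hh (inv_mem (scale_replicate_mem hr hr hr1 k)), n, ?_⟩
    have h1 := (carries_rotateRight a b c).scale_spine k
    rw [← branches_spine, ← branches_spine] at h1
    exact h1.inv.mul hn
termination_by A.leftWeight
decreasing_by
  all_goals
    simp only [BinTree.leftWeight]
    omega

/-- Both trees of a diagram are carried to the same spine by elements `a`, `b` of `H`. Then g = b⁻¹
h a, where `h` only rearranges the leaves of that spine according to `R`. -/
theorem InClass.mem_of_spine {R : List (List Bool) → List (List Bool) → Prop} (hR : Good R)
    (hP : ∀ {L M}, R L M → L.Perm M) (hr : rotateRight ∈ H) (hr1 : scale [true] rotateRight ∈ H)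
    (hH : ∀ n M, R M (spine n .leaf).branches →
      ∃ h ∈ H, Carries h (spine n .leaf).branches M)
    {g : Equiv.Perm CantorSet} (hg : InClass R g) : g ∈ H := by
  obtain ⟨A, B, M, h1, h2⟩ := inClass_iff.1 hg
  obtain ⟨a, ha, n, han⟩ := exists_carries_spine hr hr1 A 0
  obtain ⟨b, hb, m, hbm⟩ := exists_carries_spine hr hr1 B 0
  change Carries a A.branches _ at han
  change Carries b B.branches _ at hbm
  obtain rfl : n = m := by
    have e1 := h1.length_eq
    have e2 := (hP h2).length_eq
    have e3 := han.length_eq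
    have e4 := hbm.length_eq
    rw [length_branches_spine_leaf] at e3 e4
    omega
  obtain ⟨e1, e2⟩ := hbm.map_img
  have hbM : Carries b M (M.map (img b)) :=
    carries_map_img fun u hu => e1 u ((hP h2).mem_iff.1 hu)
  have h3 := hR.map (img b) h2
  rw [e2] at h3
  obtain ⟨h, hh, hc⟩ := hH n _ h3
  rw [h1.unique ((han.mul hc).mul hbM.inv)]
  exact mul_mem (inv_mem hb) (mul_mem hh ha)

theorem thompsonF_le_of_mem (hr : rotateRight ∈ H) (hr1 : scale [true] rotateRight ∈ H) :
    thompsonF ≤ H := fun g hg =>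
  InClass.mem_of_spine good_eq (fun h => h ▸ List.Perm.refl _) hr hr1
    (fun n M hM => ⟨1, H.one_mem, by
      rw [hM]
      simpa using carries_map (g := 1) (f := id) (f' := id) _ fun u w => rfl⟩)
    ((inClass_eq g).2 hg)

/-! ### Generating T: rotations of the leaves of a spine -/

/-- The map which exchanges the two halves of the Cantor set. -/
def flipHead : Equiv.Perm CantorSet where
  toFun z := Stream'.cons (!z.head) z.tail
  invFun z := Stream'.cons (!z.head) z.tail
  left_inv z := by simp
  right_inv z := by simp

theorem takes_flipHead (b : Bool) (u : List Bool) : TakesBranch flipHead (b :: u) ((!b) :: u) :=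
  fun w => by simp [flipHead, Stream'.cons_append_stream]

theorem carries_flipHead : Carries flipHead [[false], [true]] [[true], [false]] :=
  .cons (takes_flipHead false []) (.cons (takes_flipHead true []) .nil)

theorem flipHead_mem : flipHead ∈ thompsonT :=
  mem_thompsonT_iff.2 ⟨.caret .leaf .leaf, .caret .leaf .leaf, _, carries_flipHead, ⟨1, rfl⟩⟩

theorem branches_spine_leaf_succ_rotate (n : ℕ) : (spine (n + 1) .leaf).branches.rotate 1 =
    ((spine n .leaf).branches.map fun u => true :: u) ++ [[false]] := by
  simp [spine, BinTree.branches]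

/-- The rotation on a spine sends its last but one leaf to the last leaf. Splitting these two leaves
turns the target into the next spine and the source into a tree that one rotation `scale
(List.replicate k true) rotateRight` reaches from the next spine. -/
theorem exists_carries_rotate_one (hr : rotateRight ∈ H) (hr1 : scale [true] rotateRight ∈ H)
    (hf : flipHead ∈ H) (n : ℕ) :
    ∃ h ∈ H, Carries h (spine n .leaf).branches ((spine n .leaf).branches.rotate 1) := by
  match n with
  | 0 => exact ⟨1, H.one_mem, .cons (fun w => rfl) .nil⟩
  | 1 => exact ⟨flipHead, hf, carries_flipHead⟩
  | k + 2 =>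
    obtain ⟨c, hc, h⟩ := exists_carries_rotate_one hr hr1 hf (k + 1)
    refine ⟨c * scale (List.replicate k true) rotateRight,
      mul_mem hc (scale_replicate_mem hr hr hr1 k), ?_⟩
    have h1 := (carries_rotateRight .leaf .leaf .leaf).scale_spine k
    rw [← branches_spine, ← spine_succ, ← spine_succ] at h1
    refine h1.mul ?_
    rw [branches_spine_leaf_succ_rotate, branches_spine, spineBranches_succ, branches_spine,
      List.map_append, List.append_assoc, List.append_assoc] at h
    rw [branches_spine_leaf_succ_rotate, branches_spine (k + 1), spineBranches_succ,
      List.append_assoc]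
    obtain ⟨P, Q, e, h2, h3⟩ := h.exists_of_append_right
    obtain ⟨rfl, rfl⟩ := List.append_inj e (by
      have := h2.length_eq
      simpa using this.symm)
    rw [List.map_append, List.append_assoc]
    refine h2.append ?_
    simp only [BinTree.branches, List.map_cons, List.map_nil, List.cons_append, List.nil_append,
      List.append_nil] at h3 ⊢
    cases h3 with
    | cons h4 h5 =>
      cases h5 with
      | cons h6 h7 =>
        have e1 := takes_append h4 [false]
        have e2 := takes_append h4 [true]
        refine .cons ?_ (.cons ?_ (.cons ?_ .nil))
        · simpa using e1
        · simpa [List.replicate_succ'] using e2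
        · simpa [List.replicate_succ'] using h6

theorem thompsonT_le_of_mem (hr : rotateRight ∈ H) (hr1 : scale [true] rotateRight ∈ H)
    (hf : flipHead ∈ H) : thompsonT ≤ H := fun g hg => by
  refine InClass.mem_of_spine good_rot List.IsRotated.perm hr hr1 (fun n M hM => ?_)
    ((inClass_rot g).2 hg)
  obtain ⟨k, rfl⟩ := hM.symm
  obtain ⟨c, hc, h⟩ := exists_carries_rotate_one hr hr1 hf n
  refine ⟨c ^ k, pow_mem hc k, ?_⟩
  clear hM
  induction k with
  | zero =>
    simpa using carries_map (g := 1) (f := id) (f' := id) _ fun u w => rfl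
  | succ k ih =>
    have h1 := h.rotate k
    rw [List.rotate_rotate, add_comm 1 k] at h1
    rw [pow_succ']
    exact ih.mul h1

/-! ### Generating V: transpositions of adjacent leaves of a spine -/

/-- The map which exchanges the cones of `0` and `10`. -/
def swapFirst : Equiv.Perm CantorSet where
  toFun z := if z.head then (if z.tail.head then z else Stream'.cons false z.tail.tail) else
    Stream'.cons true z
  invFun z := if z.head then (if z.tail.head then z else Stream'.cons false z.tail.tail) else
    Stream'.cons true z
  left_inv z := by
    rw [← stream_cons_head_tail z, ← stream_cons_head_tail z.tail]
    cases z.head <;> cases z.tail.head <;> simp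
  right_inv z := by
    rw [← stream_cons_head_tail z, ← stream_cons_head_tail z.tail]
    cases z.head <;> cases z.tail.head <;> simp

theorem carries_swapFirst (L : List (List Bool)) :
    Carries swapFirst ([false] :: [true, false] :: L.map fun u => true :: true :: u)
      ([true, false] :: [false] :: L.map fun u => true :: true :: u) := by
  refine .cons (fun w => ?_) (.cons (fun w => ?_) (carries_map _ fun u w => ?_)) <;>
    simp [swapFirst, Stream'.cons_append_stream]

theorem swapFirst_mem : swapFirst ∈ thompsonV :=
  mem_thompsonV_iff.2 ⟨.caret .leaf (.caret .leaf .leaf), .caret .leaf (.caret .leaf .leaf), _,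
    carries_swapFirst [[]], .swap _ _ _⟩

theorem scale_true_mem_thompsonV {g : Equiv.Perm CantorSet} (hg : g ∈ thompsonV) :
    scale [true] g ∈ thompsonV := by
  obtain ⟨A, B, M, h, hM⟩ := mem_thompsonV_iff.1 hg
  have h0 : Carries (scaleBit true g) [[false]] [[false]] :=
    .cons (takes_scaleBit_not g true []) .nil
  exact mem_thompsonV_iff.2 ⟨.caret .leaf A, .caret .leaf B, _, h0.append (h.scaleBit true),
    (hM.map _).append_left _⟩

/-- A property of lists which is preserved by exchanging adjacent entries is preserved by
permutations. -/
theorem List.Perm.of_adjacent_swap {α : Type*} {Q : List α → Prop}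
    (hQ : ∀ P a b l, Q (P ++ a :: b :: l) → Q (P ++ b :: a :: l)) {l₁ l₂ : List α}
    (h : l₁.Perm l₂) (P : List α) : Q (P ++ l₁) → Q (P ++ l₂) := by
  induction h generalizing P with
  | nil => exact id
  | cons x _ ih => simpa using ih (P ++ [x])
  | swap x y l => exact hQ P y x l
  | trans _ _ ih1 ih2 => exact fun h => ih2 P (ih1 P h)

theorem thompsonV_le_of_mem (hr : rotateRight ∈ H) (hr1 : scale [true] rotateRight ∈ H)
    (hf : flipHead ∈ H) (hf1 : scale [true] flipHead ∈ H) (hs : swapFirst ∈ H)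
    (hs1 : scale [true] swapFirst ∈ H) : thompsonV ≤ H := fun g hg => by
  refine InClass.mem_of_spine good_perm id hr hr1 (fun n M hM => ?_) ((inClass_perm g).2 hg)
  refine List.Perm.of_adjacent_swap (Q := fun M => ∃ h ∈ H, Carries h (spine n .leaf).branches M)
    (fun P a b l => ?_) hM.symm [] ⟨1, H.one_mem, ?_⟩
  swap
  · simpa using carries_map (g := 1) (f := id) (f' := id) _ fun u w => rfl
  rintro ⟨h, hh, hc⟩
  obtain ⟨P', R', e, h1, h2⟩ := hc.exists_of_append_right
  cases h2 with
  | @cons a' _ R' _ ha h2 =>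
  cases h2 with
  | @cons b' _ l' _ hb h2 =>
  obtain ⟨k, hk⟩ : ∃ k, P'.length = k := ⟨_, rfl⟩
  obtain ⟨m, rfl⟩ : ∃ m, n = k + (m + 1) := by
    have h3 := congrArg List.length e
    rw [length_branches_spine_leaf] at h3
    simp only [List.length_append, List.length_cons] at h3
    exact ⟨n - k - 1, by omega⟩
  -- Leaves `k` and `k + 1` of the spine are exchanged by a copy of `flipHead` below 1^k if they are
  -- the last two, and by a copy of `swapFirst` otherwise.
  have key : ∃ s ∈ H, Carries s (P' ++ a' :: b' :: l') (P' ++ b' :: a' :: l') := by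
    rw [spine_add, branches_spine] at e
    obtain ⟨rfl, e2⟩ := List.append_inj e (by rw [length_spineBranches, hk])
    match m with
    | 0 =>
      simp only [spine, BinTree.branches, List.map_cons, List.map_nil, List.cons_append,
        List.nil_append, List.cons.injEq] at e2
      obtain ⟨rfl, rfl, rfl⟩ := e2
      exact ⟨_, scale_replicate_mem hr hf hf1 k, carries_flipHead.scale_spine k⟩
    | m + 1 =>
      simp only [spine, BinTree.branches, List.map_cons, List.map_nil, List.cons_append,
        List.nil_append, List.cons.injEq, List.map_map] at e2
      obtain ⟨rfl, rfl, rfl⟩ := e2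
      refine ⟨_, scale_replicate_mem hr hs hs1 k, ?_⟩
      have := (carries_swapFirst (spine m .leaf).branches).scale_spine k
      simpa [Function.comp_def] using this
  obtain ⟨s, hs, hsc⟩ := key
  rw [e]
  exact ⟨h * s, mul_mem hh hs, hsc.mul (h1.append (.cons hb (.cons ha h2)))⟩

/-! ### Finite generating sets and the conclusion -/

theorem group_fg_of_closure_eq {G : Subgroup (Equiv.Perm CantorSet)}
    {X : Set (Equiv.Perm CantorSet)} (hX : X.Finite) (h1 : X ⊆ G)
    (h2 : G ≤ Subgroup.closure X) : Group.FG G :=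
  (Group.fg_iff_subgroup_fg G).2 ((Subgroup.fg_iff G).2
    ⟨X, le_antisymm ((Subgroup.closure_le G).2 h1) h2, hX⟩)

theorem thompsonF_fg : Group.FG thompsonF := by
  refine group_fg_of_closure_eq (X := {rotateRight, scale [true] rotateRight}) (by simp) ?_
    (thompsonF_le_of_mem (Subgroup.subset_closure (by simp)) (Subgroup.subset_closure (by simp)))
  rintro g (rfl | rfl)
  exacts [rotateRight_mem, scaleBit_mem_thompsonF rotateRight_mem true]

theorem thompsonT_fg : Group.FG thompsonT := by
  refine group_fg_of_closure_eq (X := {rotateRight, scale [true] rotateRight, flipHead})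
    (by simp) ?_
    (thompsonT_le_of_mem (Subgroup.subset_closure (by simp)) (Subgroup.subset_closure (by simp))
      (Subgroup.subset_closure (by simp)))
  rintro g (rfl | rfl | rfl)
  exacts [thompsonF_le_thompsonT rotateRight_mem,
    thompsonF_le_thompsonT (scaleBit_mem_thompsonF rotateRight_mem true), flipHead_mem]

theorem thompsonV_fg : Group.FG thompsonV := by
  refine group_fg_of_closure_eq (X := {rotateRight, scale [true] rotateRight, flipHead,
      scale [true] flipHead, swapFirst, scale [true] swapFirst}) (by simp) ?_
    (thompsonV_le_of_mem (Subgroup.subset_closure (by simp)) (Subgroup.subset_closure (by simp))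
      (Subgroup.subset_closure (by simp)) (Subgroup.subset_closure (by simp))
      (Subgroup.subset_closure (by simp)) (Subgroup.subset_closure (by simp)))
  have hr := thompsonT_le_thompsonV (thompsonF_le_thompsonT rotateRight_mem)
  have hf := thompsonT_le_thompsonV flipHead_mem
  rintro g (rfl | rfl | rfl | rfl | rfl | rfl)
  exacts [hr, scale_true_mem_thompsonV hr, hf, scale_true_mem_thompsonV hf, swapFirst_mem,
    scale_true_mem_thompsonV swapFirst_mem]

end Generation

theorem hasLinearDivergence_of_between {G : Subgroup (Equiv.Perm CantorSet)} (hF : thompsonF ≤ G)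
    (hV : G ≤ thompsonV) (hG : Group.FG G) : HasLinearDivergence G :=
  ⟨hG, fun _ hfin hS _ _ hδ =>
    have h := linearlyJoined_of_between hF hV hfin hS
    isLinearFunction_divergence hS h.2 h.1 hδ⟩

theorem noConeHasCutPoint_of_between {G : Subgroup (Equiv.Perm CantorSet)} (hF : thompsonF ≤ G)
    (hV : G ≤ thompsonV) : NoConeHasCutPoint G :=
  fun _ hfin hS ω _ e d hd => not_hasCutPoint_of_linearlyJoined hS
    (linearlyJoined_of_between hF hV hfin hS).1 ω e d hd

theorem mainTheorem2 :
    (HasLinearDivergence thompsonF ∧ HasLinearDivergence thompsonT ∧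
      HasLinearDivergence thompsonV) ∧
    (NoConeHasCutPoint thompsonF ∧ NoConeHasCutPoint thompsonT ∧
      NoConeHasCutPoint thompsonV) := by
  have hFV := thompsonF_le_thompsonT.trans thompsonT_le_thompsonV
  exact ⟨⟨hasLinearDivergence_of_between le_rfl hFV thompsonF_fg,
    hasLinearDivergence_of_between thompsonF_le_thompsonT thompsonT_le_thompsonV thompsonT_fg,
    hasLinearDivergence_of_between hFV le_rfl thompsonV_fg⟩,
    noConeHasCutPoint_of_between le_rfl hFV,
    noConeHasCutPoint_of_between thompsonF_le_thompsonT thompsonT_le_thompsonV,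
    noConeHasCutPoint_of_between hFV le_rfl⟩
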